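/- Let $L$ be an infinite field with $\operatorname{char} L\neq 2,3$, let $a,b\in L^*$ and $f=aX^3+bY^3$, and let $F=L(\omega)$, where $\omega$ is a primitive cube root of unity (possibly $F=L$). For $k\in\{L,F\}$ let $A_{f,k}$ be the generalized Clifford algebra of $f$ over $k$, i.e. the $k$-algebra with generators $x,y$ and relations $(px+qy)^3=f(p,q)$ for all $p,q\in k$. Then $A_{f,L}$ embeds in $A_{f,F}$ (generators going to generators), and the center $Z(A_{f,k})$ is an integral domain; let $q(Z(A_{f,k}))$ be its quotient field and let $B_{f,k}=A_{f,k}\otimes_{Z(A_{f,k})}q(Z(A_{f,k}))$ be the ring of quotients of $A_{f,k}$. In $A_{f,F}$ put $$z=yx-\omega xy,\qquad \bar z=yx-\omega^2xy,\qquad r=z\bar z,\qquad s=\tfrac12(z^3+\bar z^3),\qquad u=z+\bar z,$$ and let $\sqrt c=\tfrac32(\omega-\omega^2)ab\in F$, a square root of $c=-\tfrac{27}{4}a^2b^2$. Then $r,s$ are central in $A_{f,F}$, the elements $r,s,u$ and $\omega z+\omega^2\bar z$ lie in $A_{f,L}$, $r,s$ are central in $A_{f,L}$, and $q(Z(A_{f,k}))=k(r,s)$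 for $k=L,F$. Moreover: (1) $s+\sqrt c\ne 0$, and $B_{f,F}$ is a symbol algebra of degree 3: $$B_{f,F}=F(r,s)\{x,z\}\cong(a,\,s+\sqrt c;\,F(r,s))_\omega\cong(b/a,\,s+\sqrt c;\,F(r,s))_\omega ,$$ as $F(r,s)$-algebras, where the first isomorphism takes the standard generators $i,j$ to $x,z$. Here $(t,v;K)_\omega$ is the $K$-algebra with generators $i,j$ and relations $i^3=t$, $j^3=v$, $ij=\omega ji$. (2) The element $u$ has minimal polynomial $X^3-3rX-2s$ over $L(r,s)$. The subalgebra $L(r,s)(u)$ of $B_{f,L}$ is a field, and is a cyclic Galois extension of $L(r,s)$ of degree 3 whose Galois group is generated by the automorphism $\rho$ with $\rho(u)=\omega z+\omega^2\bar z$. And $B_{f,L}$ is a cyclic algebra: $$B_{f,L}=\bigl(L(r,s)(u)/L(r,s),\,\rho,\,a\bigr)\cong\bigl(L(r,s)(u)/L(r,s),\,\rho,\,b/a\bigr),$$ where in the first description $x$ is the standard generator. Here, for a cyclic Galois extension $S/K$ of degree $n$ with Galois group generated by $\rho$ and $t\in K^*$, $(S/K,\rho,t)=\bigoplus_{i<n}Sv^i$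 with $vg=\rho(g)v$ for $g\in S$ and $v^n=t$. -/

import Mathlib

open scoped TensorProduct Polynomial IntermediateField

universe u v

/-! ### Generalized Clifford algebras -/

/-- The defining relations `(∑ pᵢ Xᵢ) ^ d = f(p)`, for all scalar vectors `p`, of the
generalized Clifford algebra of a form `f` of degree `d`. -/
inductive GenCliffordRel {k : Type u} [CommRing k] {n : ℕ} (f : MvPolynomial (Fin n) k) (d : ℕ) :
    FreeAlgebra k (Fin n) → FreeAlgebra k (Fin n) → Prop
  | pow_eq (p : Fin n → k) :
      GenCliffordRel f d ((∑ i, p i • FreeAlgebra.ι k i) ^ d)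
        (algebraMap k (FreeAlgebra k (Fin n)) (MvPolynomial.eval p f))

/-- The generalized Clifford algebra over `k` of a form `f` of degree `d` in `n` variables. -/
abbrev GenClifford {k : Type u} [CommRing k] {n : ℕ} (f : MvPolynomial (Fin n) k) (d : ℕ) :
    Type u :=
  RingQuot (GenCliffordRel f d)

/-- The canonical generators of the generalized Clifford algebra. -/
def GenClifford.gen {k : Type u} [CommRing k] {n : ℕ} (f : MvPolynomial (Fin n) k) (d : ℕ)
    (i : Fin n) : GenClifford f d :=
  RingQuot.mkAlgHom k (GenCliffordRel f d) (FreeAlgebra.ι k i)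

/-- The canonical homomorphism, sending generators to generators, from the generalized Clifford
algebra of `f` over `k` to that of `f`, viewed as a form over an extension `K` of `k`. -/
noncomputable def GenClifford.toExtension {k : Type u} [CommRing k] (K : Type v) [CommRing K] [Algebra k K]
    {n : ℕ} (f : MvPolynomial (Fin n) k) (d : ℕ) :
    GenClifford f d →ₐ[k] GenClifford (MvPolynomial.map (algebraMap k K) f) d :=
  RingQuot.liftAlgHom k
    ⟨FreeAlgebra.lift k
        (GenClifford.gen (MvPolynomial.map (algebraMap k K) f) d), by
      rintro _ _ ⟨p⟩
      have h := RingQuot.mkAlgHom_rel K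
        (GenCliffordRel.pow_eq (f := MvPolynomial.map (algebraMap k K) f) (d := d)
          (fun i => algebraMap k K (p i)))
      have hev : MvPolynomial.eval (fun i => algebraMap k K (p i))
          (MvPolynomial.map (algebraMap k K) f) = algebraMap k K (MvPolynomial.eval p f) := by
        rw [MvPolynomial.eval_map, MvPolynomial.eval₂_comp, Function.comp_def]
      rw [hev] at h
      simp only [map_pow, map_sum, AlgHom.commutes, algebraMap_smul] at h
      have hs (i : Fin n) := (RingQuot.mkAlgHom K (GenCliffordRel
        (MvPolynomial.map (algebraMap k K) f) d)).map_smul_of_tower (p i) (FreeAlgebra.ι K i)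
      simp only [hs] at h
      simp only [map_pow, map_sum, map_smul, AlgHom.commutes, FreeAlgebra.lift_ι_apply]
      rw [IsScalarTower.algebraMap_apply k K]
      exact h⟩

/-- The binary cubic form `a X³ + b Y³`. -/
noncomputable def diagCubic {k : Type u} [CommRing k] (a b : k) : MvPolynomial (Fin 2) k :=
  MvPolynomial.C a * MvPolynomial.X 0 ^ 3 + MvPolynomial.C b * MvPolynomial.X 1 ^ 3

/-- The generalized Clifford algebra over `k` of the form `a X³ + b Y³`, for `a`, `b` in `k`. -/
abbrev DiagClifford {k : Type u} [CommRing k] (a b : k) : Type u :=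
  GenClifford (diagCubic a b) 3

/-- The generalized Clifford algebra over an extension `K` of `k` of the form `a X³ + b Y³`, for
`a`, `b` in `k`. -/
abbrev DiagCliffordOver {k : Type u} [CommRing k] (K : Type v) [CommRing K] [Algebra k K]
    (a b : k) : Type v :=
  GenClifford (MvPolynomial.map (algebraMap k K) (diagCubic a b)) 3

/-! ### Rings of central quotients -/

/-- The center of the `k`-algebra `A`, as a commutative `k`-algebra. -/
def AlgCenter (k : Type u) [CommRing k] (A : Type v) [Ring A] [Algebra k A] : Type v :=
  Subalgebra.center k A

instance AlgCenter.instCommRing {k : Type u} [CommRing k] {A : Type v} [Ring A] [Algebra k A] :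
    CommRing (AlgCenter k A) :=
  inferInstanceAs (CommRing (Subalgebra.center k A))

instance AlgCenter.instAlgebra {k : Type u} [CommRing k] {A : Type v} [Ring A] [Algebra k A] :
    Algebra k (AlgCenter k A) :=
  inferInstanceAs (Algebra k (Subalgebra.center k A))

/-- Every algebra is an algebra over its center, through the inclusion. -/
instance AlgCenter.instAlgebraSelf {k : Type u} [CommRing k] {A : Type v} [Ring A]
    [Algebra k A] : Algebra (AlgCenter k A) A where
  smul z x := (z : Subalgebra.center k A).1 * x
  algebraMap := ((Subalgebra.center k A).val : Subalgebra.center k A →+* A)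
  commutes' z x := (Subalgebra.mem_center_iff.1 z.2 x).symm
  smul_def' _ _ := rfl

/-- The ring of fractions `q(Z)` of the center `Z` of the `k`-algebra `A`. -/
abbrev CenterFrac (k : Type u) [CommRing k] (A : Type v) [Ring A] [Algebra k A] : Type v :=
  FractionRing (AlgCenter k A)

/-- The ring of (central) quotients `q(A) = q(Z) ⊗_Z A`, where `Z` is the center of `A`. -/
abbrev CentralQuot (k : Type u) [CommRing k] (A : Type v) [Ring A] [Algebra k A] : Type v :=
  CenterFrac k A ⊗[AlgCenter k A] A

/-- The canonical map `A → q(A)`. -/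
def CentralQuot.of (k : Type u) [CommRing k] {A : Type v} [Ring A] [Algebra k A]
    (x : A) : CentralQuot k A :=
  1 ⊗ₜ[AlgCenter k A] x

/-! ### Symbol algebras and cyclic algebras -/

/-- The defining relations of the symbol algebra `(t, u; K)_ω`, on two generators `i`, `j`. -/
inductive SymbolRel {K : Type u} [CommRing K] (n : ℕ) (ω t u : K) :
    FreeAlgebra K (Fin 2) → FreeAlgebra K (Fin 2) → Prop
  | i_pow : SymbolRel n ω t u (FreeAlgebra.ι K 0 ^ n) (algebraMap K _ t)
  | j_pow : SymbolRel n ω t u (FreeAlgebra.ι K 1 ^ n) (algebraMap K _ u)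
  | comm : SymbolRel n ω t u (FreeAlgebra.ι K 0 * FreeAlgebra.ι K 1)
      (ω • (FreeAlgebra.ι K 1 * FreeAlgebra.ι K 0))

/-- The symbol algebra `(t, u; K)_ω` of degree `n`: the `K`-algebra with generators `i`, `j` and
relations `iⁿ = t`, `jⁿ = u`, `i j = ω j i` (for `ω` a primitive `n`-th root of unity and
`t`, `u` nonzero in a field `K`). -/
abbrev SymbolAlg {K : Type u} [CommRing K] (n : ℕ) (ω t u : K) : Type u :=
  RingQuot (SymbolRel n ω t u)

/-- The standard generator `i` of a symbol algebra. -/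
def SymbolAlg.i {K : Type u} [CommRing K] (n : ℕ) (ω t u : K) : SymbolAlg n ω t u :=
  RingQuot.mkAlgHom K (SymbolRel n ω t u) (FreeAlgebra.ι K 0)

/-- The standard generator `j` of a symbol algebra. -/
def SymbolAlg.j {K : Type u} [CommRing K] (n : ℕ) (ω t u : K) : SymbolAlg n ω t u :=
  RingQuot.mkAlgHom K (SymbolRel n ω t u) (FreeAlgebra.ι K 1)

/-- The defining relations of the cyclic algebra `(S/K, ρ, a)`.  The generators are the elements
`some s` for `s : S`, and one more generator `none`, written `v`; the relations say that `S`
maps in as a `K`-algebra, that `v s = ρ(s) v` for `s : S`, and that `v ^ [S : K] = a`. -/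
inductive CyclicRel {K : Type u} [CommRing K] {S : Type v} [CommRing S] [Algebra K S]
    (ρ : S ≃ₐ[K] S) (a : K) : FreeAlgebra K (Option S) → FreeAlgebra K (Option S) → Prop
  | scalar (c : K) : CyclicRel ρ a (FreeAlgebra.ι K (some (algebraMap K S c))) (algebraMap K _ c)
  | add (s t : S) : CyclicRel ρ a (FreeAlgebra.ι K (some (s + t)))
      (FreeAlgebra.ι K (some s) + FreeAlgebra.ι K (some t))
  | mul (s t : S) : CyclicRel ρ a (FreeAlgebra.ι K (some (s * t)))
      (FreeAlgebra.ι K (some s) * FreeAlgebra.ι K (some t))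
  | conj (s : S) : CyclicRel ρ a (FreeAlgebra.ι K none * FreeAlgebra.ι K (some s))
      (FreeAlgebra.ι K (some (ρ s)) * FreeAlgebra.ι K none)
  | v_pow : CyclicRel ρ a (FreeAlgebra.ι K none ^ Module.finrank K S) (algebraMap K _ a)

/-- The cyclic algebra `(S/K, ρ, a) = ⨁_{i < n} S vⁱ`, with `v s = ρ(s) v` and `vⁿ = a`, where
`n = [S : K]` (for `S/K` a cyclic Galois extension of fields with Galois group generated by `ρ`,
and `a` a nonzero element of `K`). -/
abbrev CyclicAlg {K : Type u} [CommRing K] {S : Type v} [CommRing S] [Algebra K S]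
    (ρ : S ≃ₐ[K] S) (a : K) : Type (max u v) :=
  RingQuot (CyclicRel ρ a)

/-- The inclusion of `S` in the cyclic algebra `(S/K, ρ, a)`. -/
def CyclicAlg.incl {K : Type u} [CommRing K] {S : Type v} [CommRing S] [Algebra K S]
    (ρ : S ≃ₐ[K] S) (a : K) (s : S) : CyclicAlg ρ a :=
  RingQuot.mkAlgHom K (CyclicRel ρ a) (FreeAlgebra.ι K (some s))

/-- The standard generator `v` of the cyclic algebra `(S/K, ρ, a)`. -/
def CyclicAlg.v {K : Type u} [CommRing K] {S : Type v} [CommRing S] [Algebra K S]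
    (ρ : S ≃ₐ[K] S) (a : K) : CyclicAlg ρ a :=
  RingQuot.mkAlgHom K (CyclicRel ρ a) (FreeAlgebra.ι K none)

/-- A subalgebra `K[w]` generated by one element is commutative, even if the ambient algebra
is not. -/
instance adjoinSingletonCommRing {K : Type u} [CommRing K] {B : Type v} [Ring B] [Algebra K B]
    (w : B) : CommRing (Algebra.adjoin K ({w} : Set B)) :=
  { (Algebra.adjoin K ({w} : Set B)).toRing with
    mul_comm := by
      have h := Algebra.isMulCommutative_adjoin K (s := ({w} : Set B)) (by
        rintro _ rfl _ rfl
        rfl)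
      exact fun s t => h.is_comm.comm s t }

/-- `S` is a field, finite over the field `K`, and `S/K` is a cyclic Galois extension whose Galois
group is generated by `ρ`: that is, `K` is the fixed field of the group generated by `ρ`. -/
def IsCyclicGalois (K : Type u) [Field K] (S : Type v) [CommRing S] [Algebra K S]
    (ρ : S ≃ₐ[K] S) : Prop :=
  IsField S ∧ Module.Finite K S ∧ IsGaloisGroup (Subgroup.zpowers ρ) K S

/-!
Put `P = y x` and `Q = x y`. The cubic relations, taken at `(1, 0)`, `(0, 1)` and `(1, ±1)`,
already give `x³ = a`, `y³ = b` and the two mixed relations, and these say that `P` and `Q`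
commute, that `P Q (P + Q) = -a b`, and that conjugation by `x` maps `P ↦ Q ↦ -P - Q ↦ P`. So the
Clifford algebra is `T ⊕ T x ⊕ T x²`, where `T = k[P, Q]` is commutative and `x` acts on it
through an automorphism `σ` of order three (`CliffordCrossedData`). All of this works over `L` and
over `F` at once: `z` and `z̄` are the combinations `P - ω Q` and `P - ω² Q`, while `u = 2 P + Q`
and its conjugate `Q - P` are already defined over `L`.

That `T` is no smaller than it should be is seen in a representation by `3 × 3` matrices over a
field `K` containing a point `(p, q)` of the curve `p q (p + q) = -a b` with `q` transcendental:
`T` acts by diagonal matrices, and its first diagonal entry embeds `T` in `K`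
(`exists_matrix_rep`, `exists_of_genClifford`). Hence `T` is a domain, and since relations `f(Q) +
g(Q) P = 0` are trivial over every field, the algebra over `L` embeds in the one over `F`
(`injective_of_map`).

The element `u` satisfies `u³ = 3 r u + 2 s`, and because the discriminant of this cubic is a
square in `k`, its conjugate is a polynomial in `u`; so `T = k[r, s][u]`. As `u` has three
distinct conjugates, a `σ`-invariant polynomial of degree at most two in `u` is constant, which
gives `T^σ = k[r, s]`, and the center of the Clifford algebra is `T^σ` (`mem_adjoin_of_fixed`,
`adjoin_center`).

After inverting the center, `T` becomes a cyclic cubic field extension `S` of `k(r, s)`, and the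
ring of quotients is a cyclic algebra on `x`, which induces `σ` (`cyclic_description`). The
element `x⁻¹ y = w x`, with `w` a unit of `T`, also induces `σ`, and its cube is `b / a`; this is
the second description. Over a field containing `ω`, `z` is an eigenvector of `σ` with `z³ = s +
√c`, which gives the symbol algebras (`symbol_description`). The comparison maps from cyclic and
symbol algebras are injective by a Vandermonde argument on conjugates, respectively on
eigenvectors (`CyclicAlg.exists_algEquiv`, `SymbolAlg.exists_algEquiv`).
-/

/-! ### The subalgebra generated by `y x` and `x y` -/

/-- The structure of a cyclic crossed product on an algebra `A` generated by `x` and `y`: a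
commutative algebra `T`, embedded in `A` by `ι`, that is generated by (the preimages of)
`P = y x` and `Q = x y`, and that `x` normalizes, acting on it through the endomorphism `σ`. -/
structure CliffordCrossedData {k : Type u} {A : Type v} [Field k] [Ring A] [Algebra k A] (a b : k)
    (x y : A) (T : Type v) [CommRing T] [Algebra k T] where
  ι : T →ₐ[k] A
  σ : T →ₐ[k] T
  P : T
  Q : T
  ι_injective : Function.Injective ι
  ι_P : ι P = y * x
  ι_Q : ι Q = x * y
  x_mul : ∀ t, x * ι t = ι (σ t) * x
  σ_P : σ P = Q
  σ_Q : σ Q = -P - Q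
  rel : P * Q * (P + Q) = -algebraMap k T (a * b)
  adjoin_eq_top : Algebra.adjoin k {P, Q} = ⊤
  x_cube : x ^ 3 = algebraMap k A a
  generate : Algebra.adjoin k {x, y} = ⊤

/-- The crossed product structure of an algebra on two generators is a formal consequence of the
cubic relations. -/
theorem CliffordCrossedData.exists_of_rel {k : Type u} {A : Type v} [Field k] [Ring A] [Algebra k A]
    {a b : k} {x y : A} (ha : a ≠ 0) (hx : x ^ 3 = algebraMap k A a)
    (hy : y ^ 3 = algebraMap k A b) (h1 : x * x * y + x * y * x + y * x * x = 0)
    (h2 : x * y * y + y * x * y + y * y * x = 0) (hgen : Algebra.adjoin k {x, y} = ⊤) :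
    ∃ (T : Type v) (_ : CommRing T) (_ : Algebra k T),
      Nonempty (CliffordCrossedData a b x y T) := by
  have hcomm : y * x * (x * y) = x * y * (y * x) := by
    rw [← sub_eq_zero]
    have : y * x * (x * y) - x * y * (y * x) = y * (x * x * y + x * y * x + y * x * x)
        - (x * y * y + y * x * y + y * y * x) * x := by noncomm_ring
    rw [this, h1, h2]; simp
  have hmc := Algebra.isMulCommutative_adjoin k (s := ({y * x, x * y} : Set A)) (by
    rintro _ (rfl | rfl) _ (rfl | rfl) <;> simp [hcomm])
  let T := Algebra.adjoin k ({y * x, x * y} : Set A)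
  let _ : CommRing T := { T.toRing with mul_comm := fun s t => hmc.is_comm.comm s t }
  have hT : ∀ t ∈ T, ∃ t' ∈ T, x * t = t' * x := by
    intro t ht
    induction ht using Algebra.adjoin_induction with
    | mem t ht =>
      rcases ht with rfl | rfl
      · exact ⟨x * y, Algebra.subset_adjoin (by simp), by noncomm_ring⟩
      · refine ⟨-(y * x) - x * y, sub_mem (neg_mem (Algebra.subset_adjoin (by simp)))
          (Algebra.subset_adjoin (by simp)), ?_⟩
        rw [← sub_eq_zero, ← h1]; noncomm_ring
    | algebraMap r => exact ⟨_, T.algebraMap_mem r, (Algebra.commutes r x).symm⟩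
    | add s t _ _ hs ht =>
      obtain ⟨s', hs', hs⟩ := hs
      obtain ⟨t', ht', ht⟩ := ht
      exact ⟨s' + t', add_mem hs' ht', by rw [mul_add, add_mul, hs, ht]⟩
    | mul s t _ _ hs ht =>
      obtain ⟨s', hs', hs⟩ := hs
      obtain ⟨t', ht', ht⟩ := ht
      exact ⟨s' * t', mul_mem hs' ht', by rw [← mul_assoc, hs, mul_assoc, ht, mul_assoc]⟩
  have hax : algebraMap k A a * algebraMap k A a⁻¹ = 1 := by
    rw [← map_mul, mul_inv_cancel₀ ha, map_one]
  -- `σ t` is characterized by `x t = σ(t) x`, because `x` is a unit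
  have hcancel : ∀ s t : A, s * x = t * x → s = t := by
    intro s t h
    have h' : s * x ^ 3 = t * x ^ 3 := by rw [pow_succ', ← mul_assoc, ← mul_assoc, h]
    rw [hx] at h'
    simpa [mul_assoc, hax] using congrArg (· * algebraMap k A a⁻¹) h'
  choose! g hgT hg using hT
  let σ : T →ₐ[k] T :=
    { toFun := fun t => ⟨g t, hgT t t.2⟩
      map_one' := Subtype.ext (hcancel _ _ (by
        change g (1 : A) * x = 1 * x
        rw [← hg _ (one_mem T)]; simp))
      map_zero' := Subtype.ext (hcancel _ _ (by
        change g (0 : A) * x = 0 * x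
        rw [← hg _ (zero_mem T)]; simp))
      map_add' := fun s t => Subtype.ext (hcancel _ _ (by
        simp only [Subalgebra.coe_add, add_mul]
        rw [← hg _ (add_mem s.2 t.2), ← hg _ s.2, ← hg _ t.2, mul_add]))
      map_mul' := fun s t => Subtype.ext (hcancel _ _ (by
        simp only [Subalgebra.coe_mul]
        rw [← hg _ (mul_mem s.2 t.2), mul_assoc, ← hg _ t.2, ← mul_assoc, ← mul_assoc, ← hg _ s.2]))
      commutes' := fun c => Subtype.ext (hcancel _ _ (by
        rw [← hg _ (Subtype.prop _)]; exact (Algebra.commutes c x).symm)) }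
  have hσ : ∀ t : T, x * t = σ t * x := fun t => hg t t.2
  let P : T := ⟨y * x, Algebra.subset_adjoin (by simp)⟩
  let Q : T := ⟨x * y, Algebra.subset_adjoin (by simp)⟩
  refine ⟨T, inferInstance, inferInstance, 
    ⟨⟨T.val, σ, P, Q, Subtype.val_injective, rfl, rfl, hσ, ?_, ?_, ?_, ?_, hx, hgen⟩⟩⟩
  · exact Subtype.ext (hcancel _ _ (by rw [← hσ]; simp [P, Q, mul_assoc]))
  · refine Subtype.ext (hcancel _ _ ?_)
    rw [← hσ]
    change x * (x * y) = (-(y * x) - x * y) * x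
    rw [← sub_eq_zero, ← h1]; noncomm_ring
  · refine Subtype.ext ?_
    change y * x * (x * y) * (y * x + x * y) = -algebraMap k A (a * b)
    have e1 : y * x * (x * y) * (y * x + x * y) = x * y * (y * (x * x * y + x * y * x + y * x * x))
        - x * y ^ 3 * x * x := by
      rw [hcomm]; noncomm_ring
    have e2 : x * algebraMap k A b * x * x = algebraMap k A b * x ^ 3 := by
      rw [← Algebra.commutes b x]; noncomm_ring
    rw [e1, h1, hy, e2, hx, mul_comm a b, map_mul]
    simp
  · have := Algebra.adjoin_adjoin_coe_preimage (R := k) (s := ({y * x, x * y} : Set A))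
    have hset : ({P, Q} : Set T) = Subtype.val ⁻¹' ({y * x, x * y} : Set A) := by
      ext t
      simp [P, Q, Subtype.ext_iff]
    rw [hset]
    exact this

namespace CliffordCrossedData

variable {k : Type u} {A : Type v} [Field k] [Ring A] [Algebra k A] {a b : k} {x y : A}
  {T : Type v} [CommRing T] [Algebra k T] (D : CliffordCrossedData a b x y T)

/-- The element `z z̄` of `T`. -/
def r : T := D.P ^ 2 + D.P * D.Q + D.Q ^ 2

/-- The element `(z³ + z̄³) / 2` of `T`. -/
def s : T := D.P ^ 3 - D.Q ^ 3 + algebraMap k T (3 / 2) * (D.P * D.Q * (D.P - D.Q))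

/-- The element `z + z̄` of `T`. -/
def u : T := 2 * D.P + D.Q

/-- The element `ω z + ω² z̄` of `T`, the conjugate of `z + z̄` under `σ`. -/
def u' : T := D.Q - D.P

lemma algebraMap_three_halves (h2 : (2 : k) ≠ 0) : algebraMap k T (3 / 2) * 2 = 3 := by
  have : (3 / 2 * 2 : k) = 3 := by field_simp
  rw [← map_ofNat (algebraMap k T) 2, ← map_ofNat (algebraMap k T) 3, ← map_mul, this]

lemma σ_u : D.σ D.u = D.u' := by simp [map_ofNat, u, u', D.σ_P, D.σ_Q]; ring
lemma σ_u' : D.σ D.u' = -D.u - D.u' := by simp [u, u', D.σ_P, D.σ_Q]; ring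
lemma σ_r : D.σ D.r = D.r := by simp [r, D.σ_P, D.σ_Q]; ring
lemma σ_s (h2 : (2 : k) ≠ 0) : D.σ D.s = D.s := by
  simp only [s, D.σ_P, D.σ_Q, map_add, map_mul, map_sub, map_pow, AlgHom.commutes]
  linear_combination -(D.Q * D.P ^ 2 + D.Q ^ 2 * D.P + D.Q ^ 3) *
    algebraMap_three_halves (T := T) h2
/-- The cubic equation of `u`; it is `(z + z̄)³ = z³ + z̄³ + 3 z z̄ (z + z̄)`. -/
lemma u_cube (h2 : (2 : k) ≠ 0) : D.u ^ 3 = 3 * D.r * D.u + 2 * D.s := by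
  simp only [s, r, u]
  linear_combination - D.P * D.Q * (D.P - D.Q) * algebraMap_three_halves (T := T) h2
/-- The conjugate of `u` is a polynomial in `u`: the discriminant of `X³ - 3 r X - 2 s` is the
square `(27 a b)²`. -/
lemma u'_eq (h2 : (2 : k) ≠ 0) :
    algebraMap k T (a * b) * (6 * D.u' + 3 * D.u) =
      2 * (D.s * D.u - D.r * D.u ^ 2 + 2 * D.r ^ 2) := by
  simp only [s, r, u, u']
  linear_combination 9 * D.Q * D.rel - D.P * D.Q * (D.P - D.Q) * (2 * D.P + D.Q) *
    algebraMap_three_halves (T := T) h2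

end CliffordCrossedData

/-! ### A faithful model of the commutative subalgebra -/

namespace CliffordCrossedData

variable {k : Type u} {A : Type v} [Field k] [Ring A] [Algebra k A] {a b : k} {x y : A}
  {T : Type v} [CommRing T] [Algebra k T] (D : CliffordCrossedData a b x y T)

open Polynomial in
/-- `T` is spanned over `k[Q, Q⁻¹]` by `1` and `P`. -/
lemma exists_pow_mul_eq (t : T) : ∃ (n : ℕ) (f g : Polynomial k),
    D.Q ^ n * t = aeval D.Q f + aeval D.Q g * D.P := by
  have ht : t ∈ Algebra.adjoin k {D.P, D.Q} := by rw [D.adjoin_eq_top]; trivial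
  induction ht using Algebra.adjoin_induction with
  | mem t ht =>
    rcases ht with rfl | rfl
    · exact ⟨0, 0, 1, by simp⟩
    · exact ⟨0, X, 0, by simp⟩
  | algebraMap c => exact ⟨0, C c, 0, by simp⟩
  | add s t _ _ hs ht =>
    obtain ⟨n, f, g, h⟩ := hs
    obtain ⟨m, f', g', h'⟩ := ht
    refine ⟨n + m, X ^ m * f + X ^ n * f', X ^ m * g + X ^ n * g', ?_⟩
    simp only [map_add, map_mul, map_pow, aeval_X]
    linear_combination D.Q ^ m * h + D.Q ^ n * h'
  | mul s t _ _ hs ht =>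
    obtain ⟨n, f, g, h⟩ := hs
    obtain ⟨m, f', g', h'⟩ := ht
    refine ⟨n + m + 1, X * f * f' - C (a * b) * g * g',
      X * (f * g' + g * f') - X ^ 2 * g * g', ?_⟩
    simp only [map_add, map_sub, map_mul, map_pow, aeval_X, aeval_C]
    have := D.rel
    rw [map_mul] at this
    linear_combination D.Q * D.Q ^ m * t * h + D.Q * (aeval D.Q f + aeval D.Q g * D.P) * h' +
      aeval D.Q g * aeval D.Q g' * this

variable (hab : a * b ≠ 0)
include hab in
lemma isUnit_Q : IsUnit D.Q := by
  refine .of_mul_eq_one (-algebraMap k T (a * b)⁻¹ * D.P * (D.P + D.Q)) ?_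
  have : algebraMap k T (a * b)⁻¹ * algebraMap k T (a * b) = 1 := by
    rw [← map_mul, inv_mul_cancel₀ hab, map_one]
  linear_combination -algebraMap k T (a * b)⁻¹ * D.rel + this

end CliffordCrossedData
section model
open Polynomial

/-- The quadratic equation `X p² + X² p + c = 0` has no root `p = -f / g` in `k(X)`: the factor `X`
can be cancelled from `f` and `g` forever. -/
lemma Polynomial.eq_zero_of_conic {k : Type u} [Field k] {c : k} (hc : c ≠ 0) (n : ℕ) :
    ∀ f g : Polynomial k, g.natDegree ≤ n →
      X * f ^ 2 - X ^ 2 * f * g + C c * g ^ 2 = 0 → g = 0 := by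
  induction n with
  | zero =>
    intro f g hg h
    rw [Nat.le_zero] at hg
    obtain ⟨d, rfl⟩ := natDegree_eq_zero.1 hg
    have := congrArg (eval 0) h
    simpa [hc] using this
  | succ n ih =>
    intro f g hg h
    have hg0 : g.coeff 0 = 0 := by
      have := congrArg (eval 0) h
      simpa [hc, ← coeff_zero_eq_eval_zero] using this
    obtain ⟨g, rfl⟩ := X_dvd_iff.2 hg0
    have h' : f ^ 2 - X ^ 2 * f * g + C c * X * g ^ 2 = 0 :=
      mul_left_cancel₀ X_ne_zero (by linear_combination h)
    have hf0 : f.coeff 0 = 0 := by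
      have := congrArg (eval 0) h'
      simpa [← coeff_zero_eq_eval_zero] using this
    obtain ⟨f, rfl⟩ := X_dvd_iff.2 hf0
    by_cases hg' : g = 0
    · simp [hg']
    rw [ih f g (by rw [natDegree_X_mul hg'] at hg; omega)
      (mul_left_cancel₀ X_ne_zero (by linear_combination h')), mul_zero]

/-- A point of the curve `p q (p + q) = -c` with `q` transcendental and `p` quadratic over `k(q)`.
-/
lemma exists_curve_point {k : Type u} [Field k] {c : k} (hc : c ≠ 0) :
    ∃ (K : Type u) (_ : Field K) (_ : Algebra k K) (p q : K), p * q * (p + q) = -algebraMap k K c ∧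
      ∀ f g : Polynomial k, aeval q f + aeval q g * p = 0 → f = 0 ∧ g = 0 := by
  let K := AlgebraicClosure (FractionRing (Polynomial k))
  let q : K := algebraMap (Polynomial k) K X
  have hinj : Function.Injective (algebraMap (Polynomial k) K) := by
    rw [IsScalarTower.algebraMap_eq (Polynomial k) (FractionRing (Polynomial k)) K]
    exact (algebraMap (FractionRing (Polynomial k)) K).injective.comp (IsFractionRing.injective _ _)
  have hq : q ≠ 0 := by simpa [q] using hinj.ne (X_ne_zero (R := k))
  obtain ⟨p, hp⟩ := IsAlgClosed.exists_root
    (C q * X ^ 2 + C (q ^ 2) * X + C (algebraMap k K c)) (by rw [degree_quadratic hq]; decide)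
  have haeval : ∀ f : Polynomial k, aeval q f = algebraMap (Polynomial k) K f := fun f => by
    rw [aeval_algebraMap_apply, aeval_X_left_apply]
  have hp' : q * p ^ 2 + q ^ 2 * p + algebraMap k K c = 0 := by simpa [IsRoot] using hp
  refine ⟨K, inferInstance, inferInstance, p, q, by linear_combination hp', fun f g h => ?_⟩
  have hg : g = 0 := by
    refine eq_zero_of_conic hc _ f g le_rfl (hinj ?_)
    simp only [map_add, map_sub, map_mul, map_pow, map_zero, ← haeval, aeval_X, aeval_C]
    linear_combination (q * (aeval q f - aeval q g * p) - q ^ 2 * aeval q g) * h +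
      (aeval q g) ^ 2 * hp'
  refine ⟨hinj ?_, hg⟩
  rw [← haeval, map_zero, ← h, hg]
  simp

/-- The representation of the Clifford algebra by matrices over `K` attached to a point `(p, q)` of
the curve `p q (p + q) = -a b`; `x y` and `y x` become the diagonal matrices with entries
`q, -p - q, p` and `p, q, -p - q`. -/
lemma exists_matrix_rep {k : Type u} [Field k] {K : Type u} [Field K] [Algebra k K] {a b : k}
    (ha : a ≠ 0) {p q : K} (hpq : p * q * (p + q) = -algebraMap k K (a * b))
    (F : MvPolynomial (Fin 2) k) (hF : ∀ v, MvPolynomial.eval v F = a * v 0 ^ 3 + b * v 1 ^ 3) :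
    ∃ φ : GenClifford F 3 →ₐ[k] Matrix (Fin 3) (Fin 3) K,
      φ (GenClifford.gen F 3 0) = !![0, 1, 0; 0, 0, 1; algebraMap k K a, 0, 0] ∧
      φ (GenClifford.gen F 3 1) = !![0, 0, p / algebraMap k K a; q, 0, 0; 0, -p - q, 0] := by
  let M : Fin 2 → Matrix (Fin 3) (Fin 3) K :=
    ![!![0, 1, 0; 0, 0, 1; algebraMap k K a, 0, 0],
      !![0, 0, p / algebraMap k K a; q, 0, 0; 0, -p - q, 0]]
  have ha' : algebraMap k K a ≠ 0 := by simpa using ha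
  refine ⟨RingQuot.liftAlgHom k ⟨FreeAlgebra.lift k M, ?_⟩, ?_, ?_⟩
  · rintro _ _ ⟨v⟩
    rw [map_mul] at hpq
    simp only [map_pow, AlgHom.commutes, hF, Fin.sum_univ_two]
    ext i j
    fin_cases i <;> fin_cases j <;>
      simp [M, pow_succ, Matrix.mul_apply, Fin.sum_univ_three,
        Matrix.algebraMap_matrix_apply, Algebra.smul_def] <;>
      field_simp
    all_goals first | ring1 | linear_combination (-(algebraMap k K (v 1)) ^ 3) * hpq
  all_goals simp [GenClifford.gen, M]

end model

namespace CliffordCrossedData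

open Polynomial in
/-- A homomorphism from `T` is injective if it preserves the independence of `1`, `P` over `k[Q]`.
-/
lemma injective_of_indep {k : Type u} {A : Type v} [Field k] [Ring A] [Algebra k A] {a b : k}
    {x y : A} {T : Type v} [CommRing T] [Algebra k T] (D : CliffordCrossedData a b x y T)
    (hab : a * b ≠ 0) {R : Type*} [CommRing R] [Algebra k R] (χ : T →ₐ[k] R)
    (hχ : ∀ f g : Polynomial k, aeval (χ D.Q) f + aeval (χ D.Q) g * χ D.P = 0 → f = 0 ∧ g = 0) :
    Function.Injective χ := by
  refine (injective_iff_map_eq_zero χ).2 fun t ht => ?_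
  obtain ⟨n, f, g, h⟩ := D.exists_pow_mul_eq t
  have h' := congrArg χ h
  simp only [map_add, map_mul, ht, mul_zero, ← aeval_algHom_apply] at h'
  obtain ⟨rfl, rfl⟩ := hχ f g h'.symm
  simpa [((D.isUnit_Q hab).pow n).mul_right_eq_zero] using h

open Polynomial in
/-- The Clifford algebra of `a X³ + b Y³` is a crossed product over a domain `T`, in which `1` and
`P` are independent over `k[Q]`. -/
theorem exists_of_genClifford {k : Type u} [Field k] (h2 : (2 : k) ≠ 0) {a b : k} (ha : a ≠ 0)
    (hb : b ≠ 0) (F : MvPolynomial (Fin 2) k)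
    (hF : ∀ v, MvPolynomial.eval v F = a * v 0 ^ 3 + b * v 1 ^ 3) :
    ∃ (T : Type u) (_ : CommRing T) (_ : IsDomain T) (_ : Algebra k T)
      (D : CliffordCrossedData a b (GenClifford.gen F 3 0) (GenClifford.gen F 3 1) T),
      ∀ f g : Polynomial k, aeval D.Q f + aeval D.Q g * D.P = 0 → f = 0 ∧ g = 0 := by
  set x := GenClifford.gen F 3 0 with hx
  set y := GenClifford.gen F 3 1 with hy
  have hrel : ∀ c d : k, (c • x + d • y) ^ 3 = algebraMap k _ (a * c ^ 3 + b * d ^ 3) := by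
    intro c d
    have h := RingQuot.mkAlgHom_rel k (GenCliffordRel.pow_eq (f := F) (d := 3) ![c, d])
    rw [hx, hy]
    simpa [hF, Fin.sum_univ_two, GenClifford.gen] using h
  have hx3 : x ^ 3 = algebraMap k _ a := by simpa using hrel 1 0
  have hy3 : y ^ 3 = algebraMap k _ b := by simpa using hrel 0 1
  have expand : ∀ c : k, (x + c • y) ^ 3 = x ^ 3 + c • (x * x * y + x * y * x + y * x * x) +
      c ^ 2 • (x * y * y + y * x * y + y * y * x) + c ^ 3 • y ^ 3 := by
    intro c
    simp only [pow_succ, pow_zero, one_mul, mul_add, add_mul, smul_mul_assoc, mul_smul_comm,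
      smul_add, smul_smul, mul_assoc]
    abel
  set R₁ := x * x * y + x * y * x + y * x * x
  set R₂ := x * y * y + y * x * y + y * y * x
  -- the mixed relations come from the values `c = 1` and `c = -1`
  have key : ∀ c : k, c • R₁ + c ^ 2 • R₂ = 0 := by
    intro c
    have h := hrel 1 c
    rw [one_smul, expand, hx3, hy3, one_pow, mul_one, map_add, Algebra.smul_def (c ^ 3), ← map_mul,
      mul_comm (c ^ 3)] at h
    linear_combination (norm := abel) h
  have hs : R₁ + R₂ = 0 := by simpa using key 1
  have hd : (-1 : k) • R₁ + R₂ = 0 := by simpa using key (-1)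
  have h22 : (2 : k) • R₁ = 0 := by
    linear_combination (norm := module) hs - hd
  have h1 : R₁ = 0 := (smul_eq_zero_iff_right h2).1 h22
  have hgen : Algebra.adjoin k {x, y} = ⊤ := by
    have := congrArg (Subalgebra.map (RingQuot.mkAlgHom k (GenCliffordRel F 3)))
      (FreeAlgebra.adjoin_range_ι k (Fin 2))
    rw [AlgHom.map_adjoin, ← Set.range_comp, Algebra.map_top,
      (AlgHom.range_eq_top _).2 (RingQuot.mkAlgHom_surjective k _)] at this
    rw [← this]
    congr 1
    ext t
    simp [Fin.exists_fin_two, hx, hy, GenClifford.gen, eq_comm]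
  obtain ⟨T, _, _, ⟨D⟩⟩ := exists_of_rel ha hx3 hy3 h1 (by rwa [h1, zero_add] at hs) hgen
  have hab := mul_ne_zero ha hb
  obtain ⟨K, _, _, p, q, hpq, hind⟩ := exists_curve_point hab
  obtain ⟨φ, hφx, hφy⟩ := exists_matrix_rep ha hpq F hF
  have ha' : algebraMap k K a ≠ 0 := by simpa using ha
  have hφP : φ (D.ι D.P) = Matrix.diagonal ![p, q, -p - q] := by
    rw [D.ι_P, map_mul, hφx, hφy]
    ext i j
    fin_cases i <;> fin_cases j <;> simp [Matrix.mul_apply, Fin.sum_univ_three, ha']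
  have hφQ : φ (D.ι D.Q) = Matrix.diagonal ![q, -p - q, p] := by
    rw [D.ι_Q, map_mul, hφx, hφy]
    ext i j
    fin_cases i <;> fin_cases j <;>
      simp [Matrix.mul_apply, Fin.sum_univ_three, mul_div_cancel₀, ha']
  have hdiag : ∀ t, ∃ d, φ (D.ι t) = Matrix.diagonal d := by
    intro t
    have ht : t ∈ Algebra.adjoin k {D.P, D.Q} := by rw [D.adjoin_eq_top]; trivial
    induction ht using Algebra.adjoin_induction with
    | mem t ht => rcases ht with rfl | rfl; exacts [⟨_, hφP⟩, ⟨_, hφQ⟩]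
    | algebraMap c =>
      exact ⟨_, by rw [AlgHom.commutes, AlgHom.commutes, Matrix.algebraMap_eq_diagonal]⟩
    | add s t _ _ hs ht =>
      obtain ⟨d, hd⟩ := hs
      obtain ⟨e, he⟩ := ht
      exact ⟨_, by rw [map_add, map_add, hd, he, Matrix.diagonal_add]⟩
    | mul s t _ _ hs ht =>
      obtain ⟨d, hd⟩ := hs
      obtain ⟨e, he⟩ := ht
      exact ⟨_, by rw [map_mul, map_mul, hd, he, Matrix.diagonal_mul_diagonal]⟩
  -- the first diagonal entry is multiplicative on diagonal matrices
  let χ : T →ₐ[k] K :=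
    { toFun := fun t => φ (D.ι t) 0 0
      map_one' := by simp
      map_zero' := by simp
      map_add' := by simp
      map_mul' := fun s t => by
        obtain ⟨d, hd⟩ := hdiag s
        obtain ⟨e, he⟩ := hdiag t
        rw [map_mul, map_mul, hd, he, Matrix.diagonal_mul_diagonal]
        simp
      commutes' := fun c => by simp [Matrix.algebraMap_matrix_apply] }
  have hP : χ D.P = p := by simp [χ, hφP]
  have hQ : χ D.Q = q := by simp [χ, hφQ]
  have hχ := D.injective_of_indep hab χ (by rwa [hP, hQ])
  refine ⟨T, inferInstance, hχ.isDomain χ.toRingHom, inferInstance, D, fun f g h => hind f g ?_⟩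
  rw [← hP, ← hQ, aeval_algHom_apply, aeval_algHom_apply, ← map_mul, ← map_add, h, map_zero]

end CliffordCrossedData

/-! ### Recognizing cyclic algebras and symbol algebras of degree three -/

/-- The powers `1, v, v²` of an element inducing `ρ` on `S` are independent over `S`, as soon as
some `g` has three distinct conjugates: the terms are told apart by right multiplication by `g`.
-/
lemma eq_zero_of_skew_sum_eq_zero {B S G : Type*} [Ring B] [CommRing S] [IsDomain S] [FunLike G S B]
    [RingHomClass G S B] {ι : G} (hι : Function.Injective ι) {ρ : S → S} {v : B}
    (hv : ∀ s, v * ι s = ι (ρ s) * v) (hv' : ∀ β : B, β * v = 0 → β = 0) {g : S}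
    (h₁ : ρ g ≠ g) (h₂ : ρ (ρ g) ≠ g) (h₁₂ : ρ (ρ g) ≠ ρ g) {s₀ s₁ s₂ : S}
    (h : ι s₀ + ι s₁ * v + ι s₂ * v ^ 2 = 0) : s₀ = 0 ∧ s₁ = 0 ∧ s₂ = 0 := by
  have hι0 : ∀ s, ι s = 0 → s = 0 := fun s hs => hι (by rw [hs, map_zero])
  have hc : ∀ s t, ι s * ι t = ι t * ι s := fun s t => by rw [← map_mul, mul_comm, map_mul]
  have hv2 : ∀ s, v ^ 2 * ι s = ι (ρ (ρ s)) * v ^ 2 := fun s => by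
    rw [pow_two, mul_assoc, hv, ← mul_assoc, hv, mul_assoc]
  have e1 : ι (s₀ * (g - ρ (ρ g))) + ι (s₁ * (ρ g - ρ (ρ g))) * v = 0 := by
    have : ι (s₀ * (g - ρ (ρ g))) + ι (s₁ * (ρ g - ρ (ρ g))) * v =
        (ι s₀ + ι s₁ * v + ι s₂ * v ^ 2) * ι g
          - ι (ρ (ρ g)) * (ι s₀ + ι s₁ * v + ι s₂ * v ^ 2) := by
      simp only [map_mul, map_sub, add_mul, mul_add, mul_sub, sub_mul, mul_assoc, hv, hv2]
      simp only [← mul_assoc, hc (ρ (ρ g))]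
      abel
    rw [this, h, mul_zero, zero_mul, sub_zero]
  have e2 : ι (s₀ * (g - ρ (ρ g)) * (g - ρ g)) = 0 := by
    have : ι (s₀ * (g - ρ (ρ g)) * (g - ρ g)) =
        (ι (s₀ * (g - ρ (ρ g))) + ι (s₁ * (ρ g - ρ (ρ g))) * v) * ι g
          - ι (ρ g) * (ι (s₀ * (g - ρ (ρ g))) + ι (s₁ * (ρ g - ρ (ρ g))) * v) := by
      generalize s₀ * (g - ρ (ρ g)) = c
      generalize s₁ * (ρ g - ρ (ρ g)) = d
      simp only [map_mul, map_sub, add_mul, mul_add, mul_sub, mul_assoc, hv]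
      simp only [← mul_assoc, hc (ρ g)]
      abel
    rw [this, e1, mul_zero, zero_mul, sub_zero]
  have hs₀ : s₀ = 0 := by
    simpa [sub_eq_zero, h₁.symm, h₂.symm] using hι0 _ e2
  subst hs₀
  have hs₁ : s₁ = 0 := by
    rw [zero_mul, map_zero, zero_add] at e1
    simpa [sub_eq_zero, h₁₂.symm] using hι0 _ (hv' _ e1)
  subst hs₁
  refine ⟨rfl, rfl, hι0 _ (hv' _ (hv' _ ?_))⟩
  rw [mul_assoc, ← pow_two]
  simpa using h

/-- An algebra generated by `S` and an element `v` that normalizes `S` and has a scalar cube is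
spanned over `S` by `1, v, v²`. -/
lemma exists_skew_sum {K B S : Type*} [Field K] [Ring B] [Algebra K B] [CommRing S] [Algebra K S]
    (ι : S →ₐ[K] B) {ρ : S → S} {v : B} (hv : ∀ s, v * ι s = ι (ρ s) * v) {t : K}
    (hv3 : v ^ 3 = algebraMap K B t) {β : B} (hβ : β ∈ Algebra.adjoin K (Set.range ι ∪ {v})) :
    ∃ s₀ s₁ s₂, β = ι s₀ + ι s₁ * v + ι s₂ * v ^ 2 := by
  suffices h : ∀ w : B, (∃ s₀ s₁ s₂, w = ι s₀ + ι s₁ * v + ι s₂ * v ^ 2) →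
      ∃ s₀ s₁ s₂, β * w = ι s₀ + ι s₁ * v + ι s₂ * v ^ 2 by
    simpa using h 1 ⟨1, 0, 0, by simp⟩
  induction hβ using Algebra.adjoin_induction with
  | mem c hc =>
    rintro _ ⟨s₀, s₁, s₂, rfl⟩
    rcases hc with ⟨c, rfl⟩ | rfl
    · exact ⟨c * s₀, c * s₁, c * s₂, by simp only [map_mul]; noncomm_ring⟩
    · refine ⟨ρ s₂ * algebraMap K S t, ρ s₀, ρ s₁, ?_⟩
      rw [map_mul, AlgHom.commutes, ← hv3]
      simp only [mul_add, ← mul_assoc, hv]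
      noncomm_ring
  | algebraMap c =>
    rintro _ ⟨s₀, s₁, s₂, rfl⟩
    exact ⟨algebraMap K S c * s₀, algebraMap K S c * s₁, algebraMap K S c * s₂, by
      simp only [map_mul, AlgHom.commutes]; noncomm_ring⟩
  | add p q _ _ hp hq =>
    intro w hw
    obtain ⟨s₀, s₁, s₂, h⟩ := hp w hw
    obtain ⟨t₀, t₁, t₂, h'⟩ := hq w hw
    exact ⟨s₀ + t₀, s₁ + t₁, s₂ + t₂, by rw [add_mul, h, h']; simp only [map_add]; noncomm_ring⟩
  | mul p q _ _ hp hq =>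
    intro w hw
    rw [mul_assoc]
    exact hp _ (hq w hw)

section CyclicAlg

/-- An algebra generated by a domain `S` of degree three and an element `v` that induces `ρ` on
`S` and has cube `t` is the cyclic algebra `(S/K, ρ, t)`. -/
theorem CyclicAlg.exists_algEquiv {K : Type u} {S : Type v} {B : Type w} [Field K]
    [CommRing S] [IsDomain S] [Algebra K S] [Ring B] [Algebra K B]
    (hS : Module.finrank K S = 3) (ρ : S ≃ₐ[K] S) {t : K}
    (ht : t ≠ 0) (ι : S →ₐ[K] B) (hι : Function.Injective ι) {v : B}
    (hv : ∀ s, v * ι s = ι (ρ s) * v) (hv3 : v ^ 3 = algebraMap K B t) {g : S}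
    (h₁ : ρ g ≠ g) (h₂ : ρ (ρ g) ≠ g) (hgen : Algebra.adjoin K (Set.range ι ∪ {v}) = ⊤) :
    ∃ e : CyclicAlg ρ t ≃ₐ[K] B, (∀ s, e (CyclicAlg.incl ρ t s) = ι s) ∧
      e (CyclicAlg.v ρ t) = v := by
  let φ : CyclicAlg ρ t →ₐ[K] B := RingQuot.liftAlgHom K
    ⟨FreeAlgebra.lift K (fun o => o.elim v ι), by
      rintro _ _ (c | ⟨c, d⟩ | ⟨c, d⟩ | c | _)
      · simp
      · simp
      · simp
      · simp [hv]
      · simp [hS, hv3]⟩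
  have hφι : ∀ s, φ (CyclicAlg.incl ρ t s) = ι s := fun s => by simp [φ, CyclicAlg.incl]
  have hφv : φ (CyclicAlg.v ρ t) = v := by simp [φ, CyclicAlg.v]
  let ι' : S →ₐ[K] CyclicAlg ρ t := AlgHom.ofLinearMap
    { toFun := CyclicAlg.incl ρ t
      map_add' := fun c d => by
        have := RingQuot.mkAlgHom_rel K (CyclicRel.add (ρ := ρ) (a := t) c d)
        rwa [map_add] at this
      map_smul' := fun c d => by
        have := RingQuot.mkAlgHom_rel K (CyclicRel.mul (ρ := ρ) (a := t) (algebraMap K S c) d)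
        rw [map_mul, RingQuot.mkAlgHom_rel K (CyclicRel.scalar (ρ := ρ) (a := t) c),
          ← Algebra.smul_def, AlgHom.commutes, ← Algebra.smul_def] at this
        exact this }
    (by
      have := RingQuot.mkAlgHom_rel K (CyclicRel.scalar (ρ := ρ) (a := t) 1)
      rwa [map_one, map_one, map_one] at this)
    (fun c d => by
      have := RingQuot.mkAlgHom_rel K (CyclicRel.mul (ρ := ρ) (a := t) c d)
      rwa [map_mul] at this)
  have hv₀ : ∀ s, CyclicAlg.v ρ t * ι' s = ι' (ρ s) * CyclicAlg.v ρ t := fun s => by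
    have := RingQuot.mkAlgHom_rel K (CyclicRel.conj (ρ := ρ) (a := t) s)
    rwa [map_mul, map_mul] at this
  have hv₀3 : CyclicAlg.v ρ t ^ 3 = algebraMap K _ t := by
    have := RingQuot.mkAlgHom_rel K (CyclicRel.v_pow (ρ := ρ) (a := t))
    rwa [map_pow, hS, AlgHom.commutes] at this
  have hgen₀ : Algebra.adjoin K (Set.range ι' ∪ {CyclicAlg.v ρ t}) = ⊤ := by
    have := congrArg (Subalgebra.map (RingQuot.mkAlgHom K (CyclicRel ρ t)))
      (FreeAlgebra.adjoin_range_ι K (Option S))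
    rw [AlgHom.map_adjoin, ← Set.range_comp, Algebra.map_top,
      (AlgHom.range_eq_top _).2 (RingQuot.mkAlgHom_surjective K _)] at this
    rw [eq_top_iff, ← this]
    refine Algebra.adjoin_mono ?_
    rintro _ ⟨_ | s, rfl⟩
    · exact Or.inr rfl
    · exact Or.inl ⟨s, rfl⟩
  have hcancel : ∀ β : B, β * v = 0 → β = 0 := fun β h => by
    have h3 : β * v ^ 3 = 0 := by rw [pow_succ', ← mul_assoc, h, zero_mul]
    rw [hv3, ← Algebra.commutes, ← Algebra.smul_def] at h3
    exact (smul_eq_zero_iff_right ht).1 h3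
  have hinj : Function.Injective φ := by
    refine (injective_iff_map_eq_zero φ).2 fun α hα => ?_
    obtain ⟨s₀, s₁, s₂, rfl⟩ := exists_skew_sum ι' hv₀ hv₀3 (β := α) (by rw [hgen₀]; trivial)
    have hφι' : ∀ s, φ (ι' s) = ι s := hφι
    simp only [map_add, map_mul, map_pow, hφι', hφv] at hα
    obtain ⟨rfl, rfl, rfl⟩ := eq_zero_of_skew_sum_eq_zero hι hv hcancel h₁ h₂ (ρ.injective.ne h₁) hα
    simp
  have hsurj : Function.Surjective φ := by
    rw [← AlgHom.range_eq_top, eq_top_iff, ← hgen, Algebra.adjoin_le_iff]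
    rintro _ (⟨s, rfl⟩ | rfl)
    exacts [⟨_, hφι s⟩, ⟨_, hφv⟩]
  exact ⟨AlgEquiv.ofBijective φ ⟨hinj, hsurj⟩, hφι, hφv⟩

end CyclicAlg

section SymbolAlg

variable {K : Type u} [Field K] {ω : K} (hω : IsPrimitiveRoot ω 3)
include hω

lemma IsPrimitiveRoot.one_add_add_sq : 1 + ω + ω ^ 2 = 0 := by
  simpa [Finset.sum_range_succ] using hω.geom_sum_eq_zero (by decide)

lemma IsPrimitiveRoot.three_ne_zero : (3 : K) ≠ 0 := by
  intro h
  have h1 : (1 - ω) * (1 - ω) = 0 := by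
    linear_combination (-ω) * h + hω.one_add_add_sq
  exact hω.ne_one (by decide) (sub_eq_zero.1 (mul_self_eq_zero.1 h1)).symm

/-- Vectors that `f` scales by `t`, `t ω`, `t ω²` and whose sum is zero are zero. -/
lemma eq_zero_of_eigenvectors {V : Type*} [AddCommGroup V] [Module K V] (f : V →ₗ[K] V) {t : K}
    (ht : t ≠ 0) {w : Fin 3 → V} (hf : ∀ n, f (w n) = (t * ω ^ (n : ℕ)) • w n)
    (h₀ : ∑ n, w n = 0) (n : Fin 3) : w n = 0 := by
  have h3 := hω.three_ne_zero
  have hs := hω.one_add_add_sq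
  have hc := hω.pow_eq_one
  have h₁ := congrArg f h₀
  have h₂ := congrArg f h₁
  simp only [map_sum, map_smul, hf, map_zero, smul_smul] at h₁ h₂
  simp only [Fin.sum_univ_three, Fin.val_zero, Fin.val_one, Fin.val_two, pow_zero, pow_one,
    mul_one] at h₀ h₁ h₂
  replace h₁ : w 0 + ω • w 1 + ω ^ 2 • w 2 = 0 := (smul_eq_zero_iff_right ht).1 (by
    rw [← h₁]; module)
  replace h₂ : w 0 + ω ^ 2 • w 1 + ω ^ 4 • w 2 = 0 :=
    (smul_eq_zero_iff_right (mul_ne_zero ht ht)).1 (by rw [← h₂]; module)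
  have hs₂ : 1 + ω ^ 2 + ω ^ 4 = 0 := by linear_combination hs + ω * hc
  have hs₃ : 1 + ω ^ 4 + ω ^ 5 = 0 := by linear_combination hs + (ω + ω ^ 2) * hc
  have hs₄ : 2 * ω ^ 3 - 2 = 0 := by linear_combination 2 * hc
  have hs₅ : ω ^ 3 + ω ^ 6 - 2 = 0 := by linear_combination (2 + ω ^ 3) * hc
  refine (smul_eq_zero_iff_right h3).1 ?_
  fin_cases n
  · change (3 : K) • w 0 = 0
    linear_combination (norm := module) h₀ + h₁ + h₂ - hs • (w 1) - hs₂ • (w 2)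
  · change (3 : K) • w 1 = 0
    linear_combination (norm := module) h₀ + ω ^ 2 • h₁ + ω • h₂ - hs • (w 0) - hs₄ • (w 1) -
      hs₃ • (w 2)
  · change (3 : K) • w 2 = 0
    linear_combination (norm := module) h₀ + ω • h₁ + ω ^ 2 • h₂ - hs • (w 0) - hs₂ • (w 1) -
      hs₅ • (w 2)

/-- An algebra whose generators satisfy the symbol relations is spanned by the nine products `iᵐ
jⁿ`. -/
lemma span_pow_mul_pow {B : Type*} [Ring B] [Algebra K B] {t v : K} {i j : B}
    (hi : i ^ 3 = algebraMap K B t) (hj : j ^ 3 = algebraMap K B v) (hij : i * j = ω • (j * i))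
    {β : B} (hβ : β ∈ Algebra.adjoin K {i, j}) :
    β ∈ Submodule.span K (Set.range fun p : Fin 3 × Fin 3 => i ^ (p.1 : ℕ) * j ^ (p.2 : ℕ)) := by
  set M := Submodule.span K (Set.range fun p : Fin 3 × Fin 3 => i ^ (p.1 : ℕ) * j ^ (p.2 : ℕ))
  have hmem : ∀ m n : ℕ, i ^ m * j ^ n ∈ M := by
    intro m n
    have hr : ∀ (c : B) (d : K), c ^ 3 = algebraMap K B d →
        ∀ m, c ^ m = d ^ (m / 3) • c ^ (m % 3) := by
      intro c d h m
      conv_lhs => rw [← Nat.div_add_mod m 3, pow_add, pow_mul, h, ← map_pow, ← Algebra.smul_def]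
    rw [hr i t hi m, hr j v hj n, smul_mul_smul_comm]
    exact M.smul_mem _ (Submodule.subset_span
      ⟨(⟨m % 3, Nat.mod_lt _ (by decide)⟩, ⟨n % 3, Nat.mod_lt _ (by decide)⟩), rfl⟩)
  have hji : j * i = ω ^ 2 • (i * j) := by
    rw [hij, smul_smul, ← pow_succ, hω.pow_eq_one, one_smul]
  have hjpow : ∀ m : ℕ, j * i ^ m = (ω ^ 2) ^ m • (i ^ m * j) := by
    intro m
    induction m with
    | zero => simp
    | succ m ih =>
      rw [pow_succ i, ← mul_assoc, ih, smul_mul_assoc, mul_assoc, hji, mul_smul_comm, smul_smul,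
        ← pow_succ, mul_assoc]
  suffices h : ∀ w ∈ M, β * w ∈ M by simpa using h 1 (by simpa using hmem 0 0)
  induction hβ using Algebra.adjoin_induction with
  | mem c hc =>
    intro w hw
    induction hw using Submodule.span_induction with
    | mem w hw =>
      obtain ⟨p, rfl⟩ := hw
      rcases hc with rfl | rfl
      · simpa [← mul_assoc, ← pow_succ'] using hmem (p.1 + 1) p.2
      · dsimp only
        rw [← mul_assoc, hjpow, smul_mul_assoc, mul_assoc, ← pow_succ']
        exact M.smul_mem _ (hmem _ _)
    | zero => simp
    | add p q _ _ hp hq => rw [mul_add]; exact add_mem hp hq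
    | smul c p _ hp => rw [mul_smul_comm]; exact M.smul_mem _ hp
  | algebraMap c => intro w hw; rw [← Algebra.smul_def]; exact M.smul_mem _ hw
  | add p q _ _ hp hq => intro w hw; rw [add_mul]; exact add_mem (hp w hw) (hq w hw)
  | mul p q _ _ hp hq => intro w hw; rw [mul_assoc]; exact hp _ (hq w hw)

/-- The products `iᵐ jⁿ` are independent in every nonzero algebra: they are simultaneous
eigenvectors, with distinct pairs of eigenvalues, of `β ↦ i β i²` and `β ↦ j β j²`. -/
lemma linearIndependent_pow_mul_pow {B : Type*} [Ring B] [Algebra K B] [Nontrivial B] {t v : K}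
    (ht : t ≠ 0) (hv : v ≠ 0) {i j : B} (hi : i ^ 3 = algebraMap K B t)
    (hj : j ^ 3 = algebraMap K B v) (hij : i * j = ω • (j * i)) :
    LinearIndependent K fun p : Fin 3 × Fin 3 => i ^ (p.1 : ℕ) * j ^ (p.2 : ℕ) := by
  have hji : j * i = ω ^ 2 • (i * j) := by
    rw [hij, smul_smul, ← pow_succ, hω.pow_eq_one, one_smul]
  have hipow : ∀ n : ℕ, i * j ^ n = ω ^ n • (j ^ n * i) := by
    intro m
    induction m with
    | zero => simp
    | succ m ih =>
      rw [pow_succ j, ← mul_assoc, ih, smul_mul_assoc, mul_assoc, hij, mul_smul_comm, smul_smul,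
        ← pow_succ, mul_assoc]
  have hjpow : ∀ m : ℕ, j * i ^ m = (ω ^ 2) ^ m • (i ^ m * j) := by
    intro m
    induction m with
    | zero => simp
    | succ m ih =>
      rw [pow_succ i, ← mul_assoc, ih, smul_mul_assoc, mul_assoc, hji, mul_smul_comm, smul_smul,
        ← pow_succ, mul_assoc]
  let f : B →ₗ[K] B := LinearMap.mulLeft K i ∘ₗ LinearMap.mulRight K (i ^ 2)
  let g : B →ₗ[K] B := LinearMap.mulLeft K j ∘ₗ LinearMap.mulRight K (j ^ 2)
  have hf : ∀ m n : ℕ, f (i ^ m * j ^ n) = (t * ω ^ n) • (i ^ m * j ^ n) := by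
    intro m n
    calc f (i ^ m * j ^ n) = i ^ m * (i * j ^ n) * i ^ 2 := by
          simp only [f, LinearMap.comp_apply, LinearMap.mulLeft_apply, LinearMap.mulRight_apply,
            ← mul_assoc, ← pow_succ, ← pow_succ']
      _ = ω ^ n • (i ^ m * j ^ n * i ^ 3) := by
          rw [hipow, pow_succ' i 2]
          simp only [mul_smul_comm, smul_mul_assoc, mul_assoc]
      _ = _ := by rw [hi, ← Algebra.commutes, ← Algebra.smul_def, smul_smul, mul_comm]
  have hg : ∀ m n : ℕ, g (i ^ m * j ^ n) = (v * (ω ^ 2) ^ m) • (i ^ m * j ^ n) := by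
    intro m n
    calc g (i ^ m * j ^ n) = (j * i ^ m) * j ^ (n + 2) := by
          simp only [g, LinearMap.comp_apply, LinearMap.mulLeft_apply, LinearMap.mulRight_apply,
            mul_assoc, pow_add]
      _ = (ω ^ 2) ^ m • (i ^ m * j ^ n * j ^ 3) := by
          rw [hjpow]
          simp only [smul_mul_assoc, mul_assoc, ← pow_add, ← pow_succ']
      _ = _ := by rw [hj, ← Algebra.commutes, ← Algebra.smul_def, smul_smul, mul_comm]
  rw [Fintype.linearIndependent_iff]
  rintro c hc ⟨m, n⟩
  rw [Fintype.sum_prod_type_right] at hc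
  have h₁ := eq_zero_of_eigenvectors hω f ht (fun n => by
    simp only [map_sum, map_smul, hf, Finset.smul_sum, smul_comm (c _)]) hc n
  have h₂ := eq_zero_of_eigenvectors (hω.pow_of_coprime 2 (by decide)) g hv (fun m => by
    simp only [map_smul, hg, smul_comm (c _)]) h₁ m
  have hunit : ∀ (d : B) (e : K), e ≠ 0 → d ^ 3 = algebraMap K B e → IsUnit d := by
    intro d e he hd
    exact (isUnit_pow_iff (by decide)).1 (hd ▸ (IsUnit.mk0 e he).map (algebraMap K B))
  have hne : i ^ (m : ℕ) * j ^ (n : ℕ) ≠ 0 :=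
    (((hunit i t ht hi).pow _).mul ((hunit j v hv hj).pow _)).ne_zero
  simpa [hne] using h₂

/-- A nonzero algebra generated by two elements that satisfy the relations of a symbol algebra of
degree three is that symbol algebra. -/
theorem SymbolAlg.exists_algEquiv {B : Type v} [Ring B] [Algebra K B] [Nontrivial B] {t v : K}
    (ht : t ≠ 0) (hv : v ≠ 0) {i j : B} (hi : i ^ 3 = algebraMap K B t)
    (hj : j ^ 3 = algebraMap K B v) (hij : i * j = ω • (j * i))
    (hgen : Algebra.adjoin K {i, j} = ⊤) :
    ∃ e : SymbolAlg 3 ω t v ≃ₐ[K] B, e (SymbolAlg.i 3 ω t v) = i ∧ e (SymbolAlg.j 3 ω t v) = j := by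
  let φ : SymbolAlg 3 ω t v →ₐ[K] B := RingQuot.liftAlgHom K
    ⟨FreeAlgebra.lift K ![i, j], by rintro _ _ (_ | _ | _) <;> simp [hi, hj, hij]⟩
  have hφi : φ (SymbolAlg.i 3 ω t v) = i := by simp [φ, SymbolAlg.i]
  have hφj : φ (SymbolAlg.j 3 ω t v) = j := by simp [φ, SymbolAlg.j]
  have hi₀ : SymbolAlg.i 3 ω t v ^ 3 = algebraMap K _ t := by
    simpa [SymbolAlg.i, SymbolAlg.j] using
      RingQuot.mkAlgHom_rel K (SymbolRel.i_pow (n := 3) (ω := ω) (t := t) (u := v))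
  have hj₀ : SymbolAlg.j 3 ω t v ^ 3 = algebraMap K _ v := by
    simpa [SymbolAlg.i, SymbolAlg.j] using
      RingQuot.mkAlgHom_rel K (SymbolRel.j_pow (n := 3) (ω := ω) (t := t) (u := v))
  have hij₀ : SymbolAlg.i 3 ω t v * SymbolAlg.j 3 ω t v =
      ω • (SymbolAlg.j 3 ω t v * SymbolAlg.i 3 ω t v) := by
    simpa [SymbolAlg.i, SymbolAlg.j] using
      RingQuot.mkAlgHom_rel K (SymbolRel.comm (n := 3) (ω := ω) (t := t) (u := v))
  have hgen₀ : Algebra.adjoin K {SymbolAlg.i 3 ω t v, SymbolAlg.j 3 ω t v} = ⊤ := by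
    have := congrArg (Subalgebra.map (RingQuot.mkAlgHom K (SymbolRel 3 ω t v)))
      (FreeAlgebra.adjoin_range_ι K (Fin 2))
    rw [AlgHom.map_adjoin, ← Set.range_comp, Algebra.map_top,
      (AlgHom.range_eq_top _).2 (RingQuot.mkAlgHom_surjective K _)] at this
    rw [← this]
    congr 1
    ext t
    simp [Fin.exists_fin_two, SymbolAlg.i, SymbolAlg.j, eq_comm]
  have hinj : Function.Injective φ := by
    refine (injective_iff_map_eq_zero φ).2 fun α hα => ?_
    obtain ⟨c, rfl⟩ := (Submodule.mem_span_range_iff_exists_fun K).1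
      (span_pow_mul_pow hω hi₀ hj₀ hij₀ (β := α) (by rw [hgen₀]; trivial))
    simp only [map_sum, map_smul, map_mul, map_pow, hφi, hφj] at hα
    have hli := linearIndependent_pow_mul_pow hω ht hv hi hj hij
    rw [Fintype.linearIndependent_iff] at hli
    have := hli c hα
    exact Finset.sum_eq_zero fun p _ => by rw [this p, zero_smul]
  have hsurj : Function.Surjective φ := by
    rw [← AlgHom.range_eq_top, eq_top_iff, ← hgen, Algebra.adjoin_le_iff]
    rintro _ (rfl | rfl)
    exacts [⟨_, hφi⟩, ⟨_, hφj⟩]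
  exact ⟨AlgEquiv.ofBijective φ ⟨hinj, hsurj⟩, hφi, hφj⟩

end SymbolAlg

/-! ### The center -/

namespace CliffordCrossedData

variable {k : Type u} {A : Type v} [Field k] [Ring A] [Algebra k A] {a b : k} {x y : A}
  {T : Type v} [CommRing T] [Algebra k T] (D : CliffordCrossedData a b x y T)

include D in
lemma isUnit_x (ha : a ≠ 0) : IsUnit x :=
  (isUnit_pow_iff (by decide : 3 ≠ 0)).1 (D.x_cube ▸ (IsUnit.mk0 a ha).map (algebraMap k A))

include D in
lemma eq_smul_sq_mul (ha : a ≠ 0) : y = a⁻¹ • (x ^ 2 * D.ι D.Q) := by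
  rw [D.ι_Q, ← mul_assoc, ← pow_succ, D.x_cube, ← Algebra.smul_def, smul_smul, inv_mul_cancel₀ ha,
    one_smul]

lemma adjoin_range_ι (ha : a ≠ 0) : Algebra.adjoin k (Set.range D.ι ∪ {x}) = ⊤ := by
  rw [eq_top_iff, ← D.generate, Algebra.adjoin_le_iff]
  have hx : x ∈ Algebra.adjoin k (Set.range D.ι ∪ {x}) := Algebra.subset_adjoin (by simp)
  rintro _ (rfl | rfl)
  · exact hx
  · have hy := Subalgebra.smul_mem _ (mul_mem (pow_mem hx 2)
      (Algebra.subset_adjoin (Or.inl ⟨D.Q, rfl⟩) : D.ι D.Q ∈ Algebra.adjoin k _)) a⁻¹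
    rwa [← D.eq_smul_sq_mul ha] at hy

lemma exists_eq_skew_sum (ha : a ≠ 0) (α : A) :
    ∃ t₀ t₁ t₂, α = D.ι t₀ + D.ι t₁ * x + D.ι t₂ * x ^ 2 :=
  exists_skew_sum D.ι D.x_mul D.x_cube (by rw [D.adjoin_range_ι ha]; trivial)

section

variable [Nontrivial T] (h3 : (3 : k) ≠ 0) (hab : a * b ≠ 0)
include h3 hab

/-- The differences between the conjugates of `u` are `3 P`, `3 Q` and `3 (P + Q)`, and `P`, `Q`,
`P + Q` divide `a b`. -/
lemma three_mul_ne_zero {t t' : T} (h : D.P * D.Q * (D.P + D.Q) = t * t') : 3 * t ≠ 0 := by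
  intro h0
  have h3' : (3 : T) ≠ 0 := by
    rw [← map_ofNat (algebraMap k T) 3]
    simpa using h3
  have : algebraMap k T (3 * (a * b)) = 0 := by
    rw [map_mul, map_ofNat]
    linear_combination 3 * D.rel - 3 * h - t' * h0
  exact mul_ne_zero h3 hab ((map_eq_zero (algebraMap k T)).1 this)

lemma σ_u_ne : D.σ D.u ≠ D.u := by
  rw [D.σ_u, ne_comm, ← sub_ne_zero, show D.u - D.u' = 3 * D.P by simp only [u, u']; ring]
  exact D.three_mul_ne_zero h3 hab (mul_assoc _ _ _)

lemma σ_σ_u_ne : D.σ (D.σ D.u) ≠ D.u := by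
  rw [D.σ_u, D.σ_u', ne_comm, ← sub_ne_zero,
    show D.u - (-D.u - D.u') = 3 * (D.P + D.Q) by simp only [u, u']; ring]
  exact D.three_mul_ne_zero h3 hab (mul_comm _ _)

lemma σ_σ_u_ne_σ_u : D.σ (D.σ D.u) ≠ D.σ D.u := by
  rw [D.σ_u, D.σ_u', ne_comm, ← sub_ne_zero,
    show D.u' - (-D.u - D.u') = 3 * D.Q by simp only [u, u']; ring]
  exact D.three_mul_ne_zero h3 hab (t' := D.P * (D.P + D.Q)) (by ring)

end

section

variable [IsDomain T] (h3 : (3 : k) ≠ 0) (ha : a ≠ 0) (hb : b ≠ 0)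
include h3 ha hb

lemma eq_zero_of_skew_sum {t₀ t₁ t₂ : T} (h : D.ι t₀ + D.ι t₁ * x + D.ι t₂ * x ^ 2 = 0) :
    t₀ = 0 ∧ t₁ = 0 ∧ t₂ = 0 :=
  have hab := mul_ne_zero ha hb
  eq_zero_of_skew_sum_eq_zero D.ι_injective D.x_mul
    (fun _ hβ => (D.isUnit_x ha).mul_left_eq_zero.1 hβ) (D.σ_u_ne h3 hab) (D.σ_σ_u_ne h3 hab)
    (D.σ_σ_u_ne_σ_u h3 hab) h

lemma exists_of_mem_center {α : A} (hα : α ∈ Subalgebra.center k A) :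
    ∃ t, D.σ t = t ∧ D.ι t = α := by
  have hab := mul_ne_zero ha hb
  rw [Subalgebra.mem_center_iff] at hα
  obtain ⟨t₀, t₁, t₂, rfl⟩ := D.exists_eq_skew_sum ha α
  have hc : ∀ s t, D.ι s * D.ι t = D.ι t * D.ι s := fun s t => by
    rw [← map_mul, mul_comm, map_mul]
  -- commuting with `u` kills the components at `x` and `x²`
  have e := hα (D.ι D.u)
  obtain ⟨-, h₁, h₂⟩ := D.eq_zero_of_skew_sum h3 ha hb (t₀ := 0) (t₁ := (D.u - D.σ D.u) * t₁)
      (t₂ := (D.u - D.σ (D.σ D.u)) * t₂) (by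
    rw [← sub_eq_zero] at e
    rw [← e]
    have hx2 : ∀ s, x ^ 2 * D.ι s = D.ι (D.σ (D.σ s)) * x ^ 2 := fun s => by
      rw [pow_two, mul_assoc, D.x_mul, ← mul_assoc, D.x_mul, mul_assoc]
    simp only [map_mul, map_sub, map_zero, mul_add, add_mul, sub_mul, mul_assoc, D.x_mul, hx2]
    simp only [← mul_assoc, hc D.u, hc (D.σ D.u), hc (D.σ (D.σ D.u))]
    abel)
  have ht₁ : t₁ = 0 := by
    simpa [sub_eq_zero, (D.σ_u_ne h3 hab).symm] using h₁
  have ht₂ : t₂ = 0 := by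
    simpa [sub_eq_zero, (D.σ_σ_u_ne h3 hab).symm] using h₂
  subst ht₁ ht₂
  refine ⟨t₀, D.ι_injective ((D.isUnit_x ha).mul_right_cancel ?_), by simp⟩
  rw [← D.x_mul]
  simpa using hα x

omit [IsDomain T] h3 hb in
lemma ι_mem_center {t : T} (ht : D.σ t = t) : D.ι t ∈ Subalgebra.center k A := by
  have hx : x * D.ι t = D.ι t * x := by rw [D.x_mul, ht]
  have : (⊤ : Subalgebra k A) ≤ Subalgebra.centralizer k {D.ι t} := by
    rw [← D.adjoin_range_ι ha, Algebra.adjoin_le_iff]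
    rintro _ (⟨s, rfl⟩ | rfl)
    · simp only [SetLike.mem_coe, Subalgebra.mem_centralizer_iff, Set.mem_singleton_iff, forall_eq]
      rw [← map_mul, mul_comm, map_mul]
    · simp only [SetLike.mem_coe, Subalgebra.mem_centralizer_iff, Set.mem_singleton_iff, forall_eq]
      exact hx.symm
  refine Subalgebra.mem_center_iff.2 fun β => ?_
  have hβ := this (Algebra.mem_top (x := β))
  simp only [Subalgebra.mem_centralizer_iff, Set.mem_singleton_iff, forall_eq] at hβ
  exact hβ.symm

end

section

variable (h2 : (2 : k) ≠ 0)
include h2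

lemma u'_mem (h3 : (3 : k) ≠ 0) (hab : a * b ≠ 0) :
    D.u' ∈ Algebra.adjoin (Algebra.adjoin k {D.r, D.s}) {D.u} := by
  set R := Algebra.adjoin k {D.r, D.s}
  have hr : D.r ∈ Algebra.adjoin R {D.u} :=
    Subalgebra.algebraMap_mem _ (⟨D.r, Algebra.subset_adjoin (by simp)⟩ : R)
  have hs : D.s ∈ Algebra.adjoin R {D.u} :=
    Subalgebra.algebraMap_mem _ (⟨D.s, Algebra.subset_adjoin (by simp)⟩ : R)
  have hk : ∀ c : k, algebraMap k T c ∈ Algebra.adjoin R {D.u} := fun c =>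
    Subalgebra.algebraMap_mem _ (algebraMap k R c)
  have hu : D.u ∈ Algebra.adjoin R {D.u} := Algebra.subset_adjoin rfl
  have h6 : (6 : k) * (a * b) ≠ 0 := by
    rw [show (6 : k) = 2 * 3 by norm_num]
    exact mul_ne_zero (mul_ne_zero h2 h3) hab
  have e : D.u' = algebraMap k T (6 * (a * b))⁻¹ * (algebraMap k T 2 * (D.s * D.u - D.r * D.u ^ 2
      + algebraMap k T 2 * D.r ^ 2) - algebraMap k T (3 * (a * b)) * D.u) := by
    have h1 : algebraMap k T (6 * (a * b))⁻¹ * algebraMap k T (6 * (a * b)) = 1 := by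
      rw [← map_mul, inv_mul_cancel₀ h6, map_one]
    have h4 := D.u'_eq h2
    rw [map_mul _ 6, map_ofNat] at h1
    rw [map_mul _ 3, map_ofNat, map_ofNat]
    linear_combination algebraMap k T (6 * (a * b))⁻¹ * h4 - D.u' * h1
  rw [e]
  exact mul_mem (hk _) (sub_mem (mul_mem (hk _) (add_mem (sub_mem (mul_mem hs hu)
    (mul_mem hr (pow_mem hu 2))) (mul_mem (hk _) (pow_mem hr 2)))) (mul_mem (hk _) hu))

/-- `T` is generated by `u` over `k[r, s]`. -/
lemma adjoin_u (h3 : (3 : k) ≠ 0) (hab : a * b ≠ 0) :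
    Algebra.adjoin (Algebra.adjoin k {D.r, D.s}) {D.u} = ⊤ := by
  have hu' := D.u'_mem h2 h3 hab
  set R := Algebra.adjoin k {D.r, D.s}
  have hu : D.u ∈ Algebra.adjoin R {D.u} := Algebra.subset_adjoin rfl
  have h3' : algebraMap k T 3⁻¹ * 3 = 1 := by
    rw [← map_ofNat (algebraMap k T) 3, ← map_mul, inv_mul_cancel₀ h3, map_one]
  have hk : ∀ c : k, algebraMap k T c ∈ Algebra.adjoin R {D.u} := fun c =>
    Subalgebra.algebraMap_mem _ (algebraMap k R c)
  have hP : D.P ∈ Algebra.adjoin R {D.u} := by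
    rw [show D.P = algebraMap k T 3⁻¹ * (D.u - D.u') by
      simp only [u, u']; linear_combination -D.P * h3']
    exact mul_mem (hk _) (sub_mem hu hu')
  have hQ : D.Q ∈ Algebra.adjoin R {D.u} := by
    rw [show D.Q = D.u' + D.P by simp only [u']; ring]
    exact add_mem hu' hP
  have : (⊤ : Subalgebra k T) ≤ (Algebra.adjoin R {D.u}).restrictScalars k := by
    rw [← D.adjoin_eq_top, Algebra.adjoin_le_iff]
    rintro _ (rfl | rfl)
    exacts [hP, hQ]
  exact eq_top_iff.2 fun t _ => this (Algebra.mem_top (x := t))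

open Polynomial in
/-- `T^σ = k[r, s]`: a fixed `t` is `q(u)` with `q` of degree at most two over `k[r, s]`, and the
polynomial `q - t` vanishes at the three conjugates of `u`. -/
lemma mem_adjoin_of_fixed [IsDomain T] (h3 : (3 : k) ≠ 0) (hab : a * b ≠ 0) {t : T}
    (ht : D.σ t = t) : t ∈ Algebra.adjoin k {D.r, D.s} := by
  classical
  have hgen := D.adjoin_u h2 h3 hab
  set R := Algebra.adjoin k {D.r, D.s} with hR
  let r' : R := ⟨D.r, Algebra.subset_adjoin (by simp)⟩
  let s' : R := ⟨D.s, Algebra.subset_adjoin (by simp)⟩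
  have hσR : ∀ c : R, D.σ (algebraMap R T c) = algebraMap R T c := by
    rintro ⟨c, hc⟩
    change D.σ c = c
    have : R ≤ AlgHom.equalizer D.σ (AlgHom.id k T) := by
      rw [hR, Algebra.adjoin_le_iff]
      rintro _ (rfl | rfl)
      exacts [D.σ_r, D.σ_s h2]
    exact this hc
  have ht' : t ∈ Algebra.adjoin R {D.u} := by rw [hgen]; trivial
  rw [Algebra.adjoin_singleton_eq_range_aeval] at ht'
  obtain ⟨p, rfl⟩ := ht'
  let m : Polynomial R := X ^ 3 - (C (3 * r') * X + C (2 * s'))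
  have hdeg : (C (3 * r') * X + C (2 * s')).degree < 3 := by compute_degree!
  have hm : m.Monic := monic_X_pow_sub (by exact_mod_cast hdeg)
  have hmu : aeval D.u m = 0 := by
    have := D.u_cube h2
    have hr : algebraMap R T r' = D.r := rfl
    have hs : algebraMap R T s' = D.s := rfl
    simp only [m, map_sub, map_add, map_mul, map_pow, aeval_X, aeval_C, hr, hs, map_ofNat]
    linear_combination this
  have hpq : (aeval D.u) p = aeval D.u (p %ₘ m) := by
    conv_lhs => rw [← modByMonic_add_div p m]
    rw [map_add, map_mul, hmu, zero_mul, add_zero]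
  change D.σ (aeval D.u p) = aeval D.u p at ht
  change aeval D.u p ∈ R
  rw [hpq] at ht ⊢
  set q := p %ₘ m
  have hq : q.natDegree < 3 := by
    have hn : m.natDegree = 3 := by simp only [m]; compute_degree!
    rw [← hn]
    exact natDegree_modByMonic_lt p hm (fun h => by simp [h] at hn)
  have hσ : ∀ v, D.σ (aeval v q) = aeval (D.σ v) q := by
    intro v
    simp only [aeval_eq_sum_range, map_sum, Algebra.smul_def, map_mul, map_pow, hσR]
  have hz : q.map (algebraMap R T) - C (aeval D.u q) = 0 := by
    refine eq_zero_of_natDegree_lt_card_of_eval_eq_zero' _ {D.u, D.σ D.u, D.σ (D.σ D.u)} ?_ ?_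
    · intro v hv
      rw [eval_sub, eval_C, eval_map_algebraMap, sub_eq_zero]
      simp only [Finset.mem_insert, Finset.mem_singleton] at hv
      rcases hv with rfl | rfl | rfl
      · rfl
      · rw [← hσ, ht]
      · rw [← hσ, ← hσ, ht, ht]
    · rw [Finset.card_eq_three.2 ⟨_, _, _, (D.σ_u_ne h3 hab).symm, (D.σ_σ_u_ne h3 hab).symm,
        (D.σ_σ_u_ne_σ_u h3 hab).symm, rfl⟩]
      refine (natDegree_sub_C ..).trans_lt (natDegree_map_le.trans_lt hq)
  have := congrArg (coeff · 0) hz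
  simp only [coeff_sub, coeff_map, coeff_C_zero, coeff_zero, sub_eq_zero] at this
  rw [← this]
  exact (q.coeff 0).2

end

end CliffordCrossedData

/-! ### The ring of central quotients -/

namespace CentralQuot

variable (k : Type u) {A : Type v} [Field k] [Ring A] [Algebra k A]

/-- `CentralQuot.of` as a homomorphism of algebras over the center. -/
noncomputable def ofHom : A →ₐ[AlgCenter k A] CentralQuot k A := Algebra.TensorProduct.includeRight

lemma ofHom_apply (α : A) : ofHom k α = of k α := rfl

lemma of_mul (α β : A) : of k (α * β) = of k α * of k β := map_mul (ofHom k) α β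
lemma of_add (α β : A) : of k (α + β) = of k α + of k β := map_add (ofHom k) α β
lemma of_pow (α : A) (n : ℕ) : of k (α ^ n) = of k α ^ n := map_pow (ofHom k) α n
lemma of_zero : of k (0 : A) = 0 := map_zero (ofHom k)

lemma of_center (c : AlgCenter k A) : of k (algebraMap _ A c) =
    algebraMap (CenterFrac k A) (CentralQuot k A) (algebraMap _ (CenterFrac k A) c) := by
  rw [← ofHom_apply, AlgHom.commutes, ← IsScalarTower.algebraMap_apply]

lemma of_algebraMap (c : k) : of k (algebraMap k A c) =
    algebraMap (CenterFrac k A) (CentralQuot k A) (algebraMap k (CenterFrac k A) c) := by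
  rw [IsScalarTower.algebraMap_apply k (AlgCenter k A) (CenterFrac k A), ← of_center]
  rfl

lemma of_smul (c : k) (α : A) : of k (c • α) = algebraMap k (CenterFrac k A) c • of k α := by
  rw [Algebra.smul_def, of_mul, of_algebraMap, ← Algebra.smul_def]

variable [IsDomain (AlgCenter k A)]

lemma of_injective (h : ∀ (c : AlgCenter k A) (α : A), c ≠ 0 → c • α = 0 → α = 0) :
    Function.Injective (of k : A → CentralQuot k A) := by
  refine (injective_iff_map_eq_zero (ofHom k)).2 fun α hα => ?_
  obtain ⟨c, hc⟩ := (IsLocalizedModule.eq_zero_iff (nonZeroDivisors (AlgCenter k A))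
    (TensorProduct.mk (AlgCenter k A) (CenterFrac k A) A 1)).1 hα
  exact h c α (nonZeroDivisors.ne_zero c.2) hc

lemma exists_smul_eq_of (β : CentralQuot k A) : ∃ (c : AlgCenter k A) (α : A),
    algebraMap _ (CenterFrac k A) c ≠ 0 ∧ algebraMap _ (CenterFrac k A) c • β = of k α := by
  obtain ⟨⟨α, c⟩, h⟩ := IsLocalizedModule.surj (nonZeroDivisors (AlgCenter k A))
    (TensorProduct.mk (AlgCenter k A) (CenterFrac k A) A 1) β
  refine ⟨c, α, ?_, ?_⟩
  · simp
  · rw [algebraMap_smul]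
    exact h

end CentralQuot

lemma IntermediateField.adjoin_fractionRing_eq_top {k Z : Type*} [Field k] [CommRing Z]
    [IsDomain Z] [Algebra k Z] {r s : Z} (h : Algebra.adjoin k {r, s} = ⊤) :
    IntermediateField.adjoin k {algebraMap Z (FractionRing Z) r, algebraMap Z (FractionRing Z) s}
      = ⊤ := by
  set E := IntermediateField.adjoin k
    {algebraMap Z (FractionRing Z) r, algebraMap Z (FractionRing Z) s}
  have hZ : ∀ c : Z, algebraMap Z (FractionRing Z) c ∈ E := by
    intro c
    have hc : c ∈ Algebra.adjoin k {r, s} := by rw [h]; trivial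
    induction hc using Algebra.adjoin_induction with
    | mem c hc =>
      rcases hc with rfl | rfl <;> exact IntermediateField.subset_adjoin _ _ (by simp)
    | algebraMap c => rw [← IsScalarTower.algebraMap_apply]; exact E.algebraMap_mem c
    | add p q _ _ hp hq => rw [map_add]; exact add_mem hp hq
    | mul p q _ _ hp hq => rw [map_mul]; exact mul_mem hp hq
  refine eq_top_iff.2 fun q _ => ?_
  obtain ⟨c, d, -, rfl⟩ := IsFractionRing.div_surjective (A := Z) q
  exact div_mem (hZ c) (hZ d)

/-- Conjugation by `v` on a subalgebra `S` that it stabilizes, when `v ^ 3` is a nonzero scalar. -/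
lemma Subalgebra.exists_conj {K B : Type*} [Field K] [Ring B] [Algebra K B] (S : Subalgebra K B)
    {v : B} {t : K} (ht : t ≠ 0) (hv : v ^ 3 = algebraMap K B t)
    (h : ∀ s ∈ S, ∃ s' ∈ S, v * s = s' * v) :
    ∃ ρ : S ≃ₐ[K] S, ∀ s : S, v * (s : B) = (ρ s : B) * v := by
  have hu : IsUnit v :=
    (isUnit_pow_iff (by decide : 3 ≠ 0)).1 (hv ▸ (IsUnit.mk0 t ht).map (algebraMap K B))
  choose! g hgS hg using h
  let f : S →ₐ[K] S := AlgHom.ofLinearMap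
    { toFun := fun s => ⟨g s, hgS s s.2⟩
      map_add' := fun s t => Subtype.ext (hu.mul_right_cancel (by
        change g (s + t) * v = (g s + g t) * v
        rw [← hg _ (add_mem s.2 t.2), add_mul, ← hg _ s.2, ← hg _ t.2, mul_add]))
      map_smul' := fun c s => Subtype.ext (hu.mul_right_cancel (by
        change g (c • s) * v = (c • g s) * v
        rw [← hg _ (S.smul_mem s.2 c), smul_mul_assoc, ← hg _ s.2, mul_smul_comm])) }
    (Subtype.ext (hu.mul_right_cancel (by
      change g 1 * v = 1 * v
      rw [← hg _ (one_mem S), mul_one, one_mul])))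
    (fun s t => Subtype.ext (hu.mul_right_cancel (by
      change g (s * t) * v = g s * g t * v
      rw [← hg _ (mul_mem s.2 t.2), mul_assoc, ← hg _ t.2, ← mul_assoc, ← mul_assoc, ← hg _ s.2])))
  have hf : ∀ s : S, v * (s : B) = (f s : B) * v := fun s => hg s s.2
  have hf3 : ∀ s : S, f (f (f s)) = s := fun s => Subtype.ext ((hu.pow 3).mul_right_cancel (by
    calc (f (f (f s)) : B) * v ^ 3 = f (f (f s)) * v * v * v := by noncomm_ring
      _ = v ^ 3 * s := by rw [← hf, mul_assoc v, ← hf, mul_assoc, mul_assoc, ← hf]; noncomm_ring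
      _ = s * v ^ 3 := by rw [hv, Algebra.commutes]))
  exact ⟨AlgEquiv.ofBijective f ⟨fun s t h => by rw [← hf3 s, h, hf3], fun s => ⟨_, hf3 s⟩⟩, hf⟩

namespace CliffordCrossedData

open CentralQuot

variable {k : Type u} {A : Type v} [Field k] [Ring A] [Algebra k A] {a b : k} {x y : A}
  {T : Type v} [CommRing T] [Algebra k T] [IsDomain T] (D : CliffordCrossedData a b x y T)
  (ha : a ≠ 0) (hb : b ≠ 0) (h2 : (2 : k) ≠ 0) (h3 : (3 : k) ≠ 0)

/-- The element of the center of `A` given by a `σ`-invariant element of `T`. -/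
def toCenter (ha : a ≠ 0) (t : T) (ht : D.σ t = t) : AlgCenter k A :=
  (⟨D.ι t, D.ι_mem_center ha ht⟩ : Subalgebra.center k A)

omit [IsDomain T] in
lemma algebraMap_toCenter {t : T} (ht : D.σ t = t) :
    algebraMap _ A (D.toCenter ha t ht) = D.ι t := rfl

omit [IsDomain T] in
lemma toCenter_eq_zero {t : T} (ht : D.σ t = t) (h : t = 0) : D.toCenter ha t ht = 0 :=
  Subtype.ext (by subst h; exact map_zero D.ι)

include D ha hb h3 in
lemma exists_eq_toCenter (c : AlgCenter k A) : ∃ t, ∃ ht : D.σ t = t, c = D.toCenter ha t ht := by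
  obtain ⟨t, ht, h⟩ := D.exists_of_mem_center h3 ha hb
    (Subtype.property (p := (· ∈ Subalgebra.center k A)) c)
  exact ⟨t, ht, Subtype.ext h.symm⟩

include D ha hb h3 in
theorem isDomain_center : IsDomain (AlgCenter k A) := by
  have : Nontrivial A := D.ι_injective.nontrivial
  have : Nontrivial (AlgCenter k A) := inferInstanceAs (Nontrivial (Subalgebra.center k A))
  have : NoZeroDivisors (AlgCenter k A) := ⟨by
    intro c d h
    obtain ⟨s, hs, rfl⟩ := D.exists_eq_toCenter ha hb h3 c
    obtain ⟨t, ht, rfl⟩ := D.exists_eq_toCenter ha hb h3 d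
    have h' := congrArg (algebraMap _ A) h
    rw [map_mul, algebraMap_toCenter, algebraMap_toCenter, ← map_mul, map_zero,
      map_eq_zero_iff _ D.ι_injective, mul_eq_zero] at h'
    exact h'.imp (D.toCenter_eq_zero ha hs) (D.toCenter_eq_zero ha ht)⟩
  exact NoZeroDivisors.to_isDomain _

include hb h3 in
/-- The center of `A` is `k[r, s]`. -/
lemma adjoin_center :
    Algebra.adjoin k {D.toCenter ha D.r D.σ_r, D.toCenter ha D.s (D.σ_s h2)} = ⊤ := by
  have key : ∀ t ∈ Algebra.adjoin k {D.r, D.s}, ∃ c ∈ Algebra.adjoin k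
      {D.toCenter ha D.r D.σ_r, D.toCenter ha D.s (D.σ_s h2)}, algebraMap _ A c = D.ι t := by
    intro t ht
    induction ht using Algebra.adjoin_induction with
    | mem t ht => 
      rcases ht with rfl | rfl
      exacts [⟨_, Algebra.subset_adjoin (Or.inl rfl), rfl⟩,
        ⟨_, Algebra.subset_adjoin (Or.inr rfl), rfl⟩]
    | algebraMap c => exact ⟨_, Subalgebra.algebraMap_mem _ c, by rw [AlgHom.commutes]; rfl⟩
    | add p q _ _ hp hq =>
      obtain ⟨c, hc, hp⟩ := hp
      obtain ⟨d, hd, hq⟩ := hq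
      exact ⟨c + d, add_mem hc hd, by rw [map_add, map_add, hp, hq]⟩
    | mul p q _ _ hp hq =>
      obtain ⟨c, hc, hp⟩ := hp
      obtain ⟨d, hd, hq⟩ := hq
      exact ⟨c * d, mul_mem hc hd, by rw [map_mul, map_mul, hp, hq]⟩
  refine eq_top_iff.2 fun c _ => ?_
  obtain ⟨t, ht, rfl⟩ := D.exists_eq_toCenter ha hb h3 c
  obtain ⟨c, hc, h⟩ := key t (D.mem_adjoin_of_fixed h2 h3 (mul_ne_zero ha hb) ht)
  convert hc
  exact Subtype.ext h.symm

variable [IsDomain (AlgCenter k A)]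

include D ha hb h3 in
/-- `A` is torsion-free over its center, so it embeds in its ring of quotients. -/
lemma of_injective : Function.Injective (of k : A → CentralQuot k A) := by
  refine CentralQuot.of_injective k fun c α hc h => ?_
  obtain ⟨t, ht, rfl⟩ := D.exists_eq_toCenter ha hb h3 c
  have ht0 : t ≠ 0 := by
    exact fun h => hc (D.toCenter_eq_zero ha ht h)
  obtain ⟨t₀, t₁, t₂, rfl⟩ := D.exists_eq_skew_sum ha α
  rw [Algebra.smul_def, algebraMap_toCenter] at h
  obtain ⟨h₀, h₁, h₂⟩ := D.eq_zero_of_skew_sum h3 ha hb (t₀ := t * t₀) (t₁ := t * t₁) (t₂ := t * t₂)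
    (by rw [← h]; simp only [map_mul]; noncomm_ring)
  simp only [mul_eq_zero, ht0, false_or] at h₀ h₁ h₂
  simp [h₀, h₁, h₂]

end CliffordCrossedData

/-! ### The cyclic algebra -/

open Polynomial in
/-- If `K[w]` is a domain with an automorphism that gives `w` three distinct conjugates, and `w`
is a root of the monic cubic `m`, then `m` is the minimal polynomial of `w` and `K[w]` is a cubic
field. -/
lemma Algebra.adjoin_singleton_of_cubic {K : Type u} {B : Type v} [Field K] [Ring B] [Algebra K B]
    {w : B} [IsDomain (Algebra.adjoin K {w})]
    (ρ : Algebra.adjoin K {w} ≃ₐ[K] Algebra.adjoin K {w}) {g : Algebra.adjoin K {w}}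
    (hg : (g : B) = w) (hg₁ : ρ g ≠ g) (hg₂ : ρ (ρ g) ≠ g) {m : Polynomial K} (hmonic : m.Monic)
    (hmdeg : m.natDegree = 3) (hroot : aeval w m = 0) :
    minpoly K w = m ∧ IsField (Algebra.adjoin K {w}) ∧ Module.Finite K (Algebra.adjoin K {w}) ∧
      Module.finrank K (Algebra.adjoin K {w}) = 3 := by
  classical
  have : Nontrivial B := (Subtype.val_injective (p := (· ∈ Algebra.adjoin K {w}))).nontrivial
  have hg₁₂ : ρ (ρ g) ≠ ρ g := ρ.injective.ne hg₁
  have hmin : minpoly K w = m := by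
    refine (minpoly.unique' K _ hmonic hroot fun q hq => ?_).symm
    rw [or_iff_not_imp_right, not_not]
    intro hqu
    have hqg : aeval g q = 0 := by
      refine Subtype.ext ((aeval_algHom_apply (Algebra.adjoin K {w}).val g q).symm.trans ?_)
      rw [Subalgebra.val_apply, hg, hqu]
      rfl
    have hz : q.map (algebraMap K (Algebra.adjoin K {w})) = 0 := by
      refine eq_zero_of_natDegree_lt_card_of_eval_eq_zero' _ {g, ρ g, ρ (ρ g)} ?_ ?_
      · intro v hv
        rw [eval_map_algebraMap]
        simp only [Finset.mem_insert, Finset.mem_singleton] at hv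
        rcases hv with rfl | rfl | rfl
        · exact hqg
        · rw [aeval_algHom_apply, hqg, map_zero]
        · rw [aeval_algHom_apply, aeval_algHom_apply, hqg, map_zero, map_zero]
      · rw [Finset.card_eq_three.2 ⟨_, _, _, hg₁.symm, hg₂.symm, hg₁₂.symm, rfl⟩, natDegree_map]
        by_cases hq0 : q = 0
        · simp [hq0]
        · rw [← hmdeg]
          exact natDegree_lt_natDegree hq0 hq
    exact (Polynomial.map_eq_zero _).1 hz
  have hint : IsIntegral K w := ⟨m, hmonic, hroot⟩
  have hfin : Module.Finite K (Algebra.adjoin K {w}) :=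
    Algebra.finite_adjoin_simple_of_isIntegral hint
  refine ⟨hmin, isField_of_isIntegral_of_isField' (S := Algebra.adjoin K {w}) (Field.toIsField K),
    hfin, ?_⟩
  have htop : Algebra.adjoin K {g} = ⊤ := by
    refine Subalgebra.map_injective (f := (Algebra.adjoin K {w}).val) Subtype.val_injective ?_
    rw [AlgHom.map_adjoin, Algebra.map_top, Subalgebra.range_val, Set.image_singleton,
      Subalgebra.val_apply, hg]
  rw [(PowerBasis.ofAdjoinEqTop (Algebra.IsIntegral.isIntegral g) htop).finrank,
    PowerBasis.ofAdjoinEqTop_dim,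
    ← minpoly.algHom_eq (Algebra.adjoin K {w}).val Subtype.val_injective, Subalgebra.val_apply, hg,
    hmin, hmdeg]

/-- `CyclicAlg.exists_algEquiv` for a subalgebra generated by one element. -/
theorem CyclicAlg.exists_algEquiv_adjoin {K : Type u} {B : Type v} [Field K] [Ring B] [Algebra K B]
    {w : B} [IsDomain (Algebra.adjoin K {w})] (hS : Module.finrank K (Algebra.adjoin K {w}) = 3)
    (ρ : Algebra.adjoin K {w} ≃ₐ[K] Algebra.adjoin K {w}) {t : K} (ht : t ≠ 0) {v : B}
    (hv : ∀ s : Algebra.adjoin K {w}, v * (s : B) = (ρ s : B) * v)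
    (hv3 : v ^ 3 = algebraMap K B t) {g : Algebra.adjoin K {w}} (h₁ : ρ g ≠ g) (h₂ : ρ (ρ g) ≠ g)
    (hgen : ∀ U : Subalgebra K B, Algebra.adjoin K {w} ≤ U → v ∈ U → U = ⊤) :
    ∃ e : CyclicAlg (S := Algebra.adjoin K {w}) ρ t ≃ₐ[K] B,
      (∀ s : Algebra.adjoin K {w}, e (CyclicAlg.incl (S := Algebra.adjoin K {w}) ρ t s) = s.1) ∧
      e (CyclicAlg.v (S := Algebra.adjoin K {w}) ρ t) = v := by
  let ι : Algebra.adjoin K {w} →ₐ[K] B := (Algebra.adjoin K {w}).val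
  refine CyclicAlg.exists_algEquiv hS ρ ht ι Subtype.val_injective hv hv3 h₁ h₂ (hgen _ ?_ ?_)
  · exact fun s hs => Algebra.subset_adjoin (Or.inl ⟨⟨s, hs⟩, rfl⟩)
  · exact Algebra.subset_adjoin (Or.inr rfl)

namespace CliffordCrossedData

open CentralQuot

variable {k : Type u} {A : Type v} [Field k] [Ring A] [Algebra k A] {a b : k} {x y : A}
  {T : Type v} [CommRing T] [Algebra k T] (D : CliffordCrossedData a b x y T)

/-- The element `σ(Q) / a` of `T`, for which `x⁻¹ y = w x`. -/
def w : T := -algebraMap k T a⁻¹ * (D.P + D.Q)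

/-- The inverse of `w`. -/
def w' : T := algebraMap k T b⁻¹ * (D.P * D.Q)

lemma w_mul_w' (ha : a ≠ 0) (hb : b ≠ 0) : D.w * D.w' = 1 := by
  have h : algebraMap k T a⁻¹ * algebraMap k T b⁻¹ * algebraMap k T (a * b) = 1 := by
    rw [← map_mul, ← map_mul, ← map_one (algebraMap k T)]
    congr 1
    field_simp
  simp only [w, w']
  linear_combination h - algebraMap k T a⁻¹ * algebraMap k T b⁻¹ * D.rel

/-- The cube of `w x` is the norm `w σ(w) σ²(w)` times `a`. -/
lemma w_mul_x_pow (ha : a ≠ 0) : (D.ι D.w * x) ^ 3 = algebraMap k A (b / a) := by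
  have e : (D.ι D.w * x) ^ 3 = D.ι (D.w * D.σ D.w * D.σ (D.σ D.w)) * x ^ 3 := by
    simp only [map_mul, pow_succ, pow_zero, one_mul]
    calc D.ι D.w * x * (D.ι D.w * x) * (D.ι D.w * x)
        = D.ι D.w * (x * D.ι D.w) * (x * D.ι D.w) * x := by noncomm_ring
      _ = D.ι D.w * D.ι (D.σ D.w) * (x * D.ι (D.σ D.w)) * x * x := by
        rw [D.x_mul]; noncomm_ring
      _ = _ := by rw [D.x_mul]; noncomm_ring
  have e' : D.w * D.σ D.w * D.σ (D.σ D.w) = algebraMap k T (a⁻¹ ^ 2 * b) := by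
    have h : algebraMap k T a⁻¹ ^ 3 * algebraMap k T (a * b) = algebraMap k T (a⁻¹ ^ 2 * b) := by
      rw [← map_pow, ← map_mul]
      congr 1
      field_simp
    have := D.rel
    rw [← h]
    simp only [w, map_mul, map_neg, AlgHom.commutes, map_add, D.σ_P, D.σ_Q, map_sub]
    rw [map_mul] at this
    linear_combination -algebraMap k T a⁻¹ ^ 3 * this
  rw [e, e', D.x_cube, AlgHom.commutes, ← map_mul]
  congr 1
  field_simp

variable [IsDomain T] [IsDomain (AlgCenter k A)]

omit [IsDomain T] [IsDomain (AlgCenter k A)] in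
lemma of_x_mul (t : T) : of k x * of k (D.ι t) = of k (D.ι (D.σ t)) * of k x := by
  rw [← of_mul, D.x_mul, of_mul]

omit [IsDomain T] in
/-- The ring of quotients is generated by `x` and `Q = x y`. -/
lemma eq_top_of_mem (ha : a ≠ 0) {U : Subalgebra (CenterFrac k A) (CentralQuot k A)}
    (hx : of k x ∈ U) (hQ : of k (D.ι D.Q) ∈ U) : U = ⊤ := by
  have hy : of k y ∈ U := by
    have := U.smul_mem (mul_mem (pow_mem hx 2) hQ) (algebraMap k _ a⁻¹)
    rwa [← of_pow, ← of_mul, ← of_smul, ← D.eq_smul_sq_mul ha] at this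
  have hA : ∀ α : A, of k α ∈ U := by
    intro α
    have hα : α ∈ Algebra.adjoin k {x, y} := by rw [D.generate]; trivial
    induction hα using Algebra.adjoin_induction with
    | mem α hα => rcases hα with h | h <;> rw [h] <;> assumption
    | algebraMap c => rw [of_algebraMap]; exact U.algebraMap_mem _
    | add p q _ _ hp hq => rw [of_add]; exact add_mem hp hq
    | mul p q _ _ hp hq => rw [of_mul]; exact mul_mem hp hq
  refine eq_top_iff.2 fun β _ => ?_
  obtain ⟨c, α, hc, h⟩ := exists_smul_eq_of k β
  have := U.smul_mem (hA α) (algebraMap _ (CenterFrac k A) c)⁻¹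
  rwa [← h, smul_smul, inv_mul_cancel₀ hc, one_smul] at this

omit [IsDomain T] [IsDomain (AlgCenter k A)] in
lemma toCenter_smul (ha : a ≠ 0) {t : T} (ht : D.σ t = t) (β : CentralQuot k A) :
    algebraMap _ (CenterFrac k A) (D.toCenter ha t ht) • β = of k (D.ι t) * β := by
  rw [← D.algebraMap_toCenter ha ht, of_center]
  exact Algebra.smul_def (R := CenterFrac k A) (A := CentralQuot k A) _ _

/-- Elements of `q(Z)(u)` are fractions with numerators in `T` and denominators in the center. -/
lemma exists_smul_eq_of_mem_adjoin (ha : a ≠ 0) (hb : b ≠ 0) (h3 : (3 : k) ≠ 0)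
    {β : CentralQuot k A} (hβ : β ∈ Algebra.adjoin (CenterFrac k A) {of k (D.ι D.u)}) :
    ∃ (c : AlgCenter k A) (t : T), algebraMap _ (CenterFrac k A) c ≠ 0 ∧
      algebraMap _ (CenterFrac k A) c • β = of k (D.ι t) := by
  induction hβ using Algebra.adjoin_induction with
  | mem β hβ =>
    obtain rfl := hβ
    exact ⟨1, D.u, by simp, by simp⟩
  | algebraMap q =>
    obtain ⟨n, d, hd, rfl⟩ := IsFractionRing.div_surjective (A := AlgCenter k A) q
    have hd' : algebraMap _ (CenterFrac k A) d ≠ 0 := by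
      simpa using nonZeroDivisors.ne_zero hd
    obtain ⟨t, ht, rfl⟩ := D.exists_eq_toCenter ha hb h3 n
    refine ⟨d, t, hd', ?_⟩
    rw [← D.algebraMap_toCenter ha ht, of_center]
    refine (Algebra.smul_def (R := CenterFrac k A) (A := CentralQuot k A) _ _).trans ?_
    rw [← map_mul, mul_div_cancel₀ _ hd']
  | add p q _ _ hp hq =>
    obtain ⟨c, t, hc, hp⟩ := hp
    obtain ⟨c', t', hc', hq⟩ := hq
    obtain ⟨d, hd, rfl⟩ := D.exists_eq_toCenter ha hb h3 c
    obtain ⟨d', hd', rfl⟩ := D.exists_eq_toCenter ha hb h3 c'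
    refine ⟨_ * _, d' * t + d * t', by rw [map_mul]; exact mul_ne_zero hc hc', ?_⟩
    rw [map_mul, smul_add, mul_smul _ _ q, hq, mul_comm, mul_smul, hp, toCenter_smul, toCenter_smul,
      map_add, map_mul, map_mul, of_add, of_mul, of_mul]
  | mul p q _ _ hp hq =>
    obtain ⟨c, t, hc, hp⟩ := hp
    obtain ⟨c', t', hc', hq⟩ := hq
    refine ⟨c * c', t * t', by rw [map_mul]; exact mul_ne_zero hc hc', ?_⟩
    rw [map_mul, ← smul_mul_smul_comm, hp, hq, map_mul, of_mul]

omit [IsDomain T] [IsDomain (AlgCenter k A)] in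
/-- `T` lies in `q(Z)(u)`. -/
lemma of_ι_mem_adjoin (ha : a ≠ 0) (hb : b ≠ 0) (h2 : (2 : k) ≠ 0) (h3 : (3 : k) ≠ 0) (t : T) :
    of k (D.ι t) ∈ Algebra.adjoin (CenterFrac k A) {of k (D.ι D.u)} := by
  have ht : t ∈ Algebra.adjoin (Algebra.adjoin k {D.r, D.s}) {D.u} := by
    rw [D.adjoin_u h2 h3 (mul_ne_zero ha hb)]; trivial
  induction ht using Algebra.adjoin_induction with
  | mem t ht =>
    obtain rfl := ht
    exact Algebra.subset_adjoin rfl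
  | algebraMap c =>
    have hc : D.σ c = c := by
      have : Algebra.adjoin k {D.r, D.s} ≤ AlgHom.equalizer D.σ (AlgHom.id k T) := by
        rw [Algebra.adjoin_le_iff]
        rintro _ (rfl | rfl)
        exacts [D.σ_r, D.σ_s h2]
      exact this c.2
    change of k (D.ι c) ∈ _
    rw [← D.algebraMap_toCenter ha hc, of_center]
    exact Subalgebra.algebraMap_mem _ _
  | add p q _ _ hp hq => rw [map_add, of_add]; exact add_mem hp hq
  | mul p q _ _ hp hq => rw [map_mul, of_mul]; exact mul_mem hp hq

open Polynomial in
omit [IsDomain T] [IsDomain (AlgCenter k A)] in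
lemma aeval_u (ha : a ≠ 0) (h2 : (2 : k) ≠ 0) :
    aeval (of k (D.ι D.u)) (X ^ 3
      - C (3 * algebraMap _ (CenterFrac k A) (D.toCenter ha D.r D.σ_r)) * X
      - C (2 * algebraMap _ (CenterFrac k A) (D.toCenter ha D.s (D.σ_s h2)))) = 0 := by
  have e := congrArg (fun t => of k (D.ι t)) (D.u_cube h2)
  simp only [map_add, map_mul, map_pow, map_ofNat, of_add, of_mul, of_pow] at e
  have h3' : of k (3 : A) = 3 := map_ofNat (ofHom k) 3
  have h2' : of k (2 : A) = 2 := map_ofNat (ofHom k) 2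
  simp only [map_sub, map_mul, map_pow, aeval_X, aeval_C, map_ofNat, ← of_center,
    algebraMap_toCenter]
  rw [e, h3', h2']
  abel

open Polynomial in
/-- The ring of quotients of `A` as a cyclic algebra over `q(Z)(u)`, on the generators `x` and
`w x = x⁻¹ y`. -/
theorem cyclic_description (ha : a ≠ 0) (hb : b ≠ 0) (h2 : (2 : k) ≠ 0) (h3 : (3 : k) ≠ 0) :
    let Q := CenterFrac k A
    let B := CentralQuot k A
    let S : Subalgebra Q B := Algebra.adjoin Q {of k (D.ι D.u)}
    minpoly Q (of k (D.ι D.u) : B) = X ^ 3 - C (3 * algebraMap _ Q (D.toCenter ha D.r D.σ_r)) * X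
        - C (2 * algebraMap _ Q (D.toCenter ha D.s (D.σ_s h2))) ∧
      ∃ ρ : S ≃ₐ[Q] S,
        IsCyclicGalois Q S ρ ∧
        (ρ ⟨of k (D.ι D.u), Algebra.self_mem_adjoin_singleton Q _⟩).1 = of k (D.ι D.u') ∧
        (∃ e : CyclicAlg (S := S) ρ (algebraMap k Q a) ≃ₐ[Q] B,
           (∀ t : S, e (CyclicAlg.incl (S := S) ρ _ t) = t.1) ∧
           e (CyclicAlg.v (S := S) ρ _) = of k x) ∧
        Nonempty (CyclicAlg (S := S) ρ (algebraMap k Q (b / a)) ≃ₐ[Q] B) := by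
  classical
  intro Q B S
  have hinj := D.of_injective ha hb h3
  have : Nontrivial B := by
    have : Nontrivial A := D.ι_injective.nontrivial
    exact hinj.nontrivial
  have hab := mul_ne_zero ha hb
  have hk : ∀ c : k, c ≠ 0 → algebraMap k Q c ≠ 0 := fun c hc => by simpa using hc
  have hx3 : of k x ^ 3 = algebraMap Q B (algebraMap k Q a) := by
    rw [← of_pow, D.x_cube, of_algebraMap]
  have hxu : IsUnit (of k x) := (D.isUnit_x ha).map (ofHom k)
  have hS : ∀ β ∈ S, ∃ (c : Q) (t : T), c ≠ 0 ∧ c • β = of k (D.ι t) := fun β hβ =>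
    let ⟨c, t, hc, h⟩ := D.exists_smul_eq_of_mem_adjoin ha hb h3 hβ
    ⟨_, t, hc, h⟩
  have hTS : ∀ t, of k (D.ι t) ∈ S := D.of_ι_mem_adjoin ha hb h2 h3
  obtain ⟨ρ, hρ⟩ := S.exists_conj (hk a ha) hx3 (fun β hβ => by
    obtain ⟨c, t, hc, h⟩ := hS β hβ
    refine ⟨c⁻¹ • of k (D.ι (D.σ t)), S.smul_mem (hTS _) _, ?_⟩
    rw [smul_mul_assoc, ← D.of_x_mul, ← h, mul_smul_comm, smul_smul, inv_mul_cancel₀ hc, one_smul])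
  have hρT : ∀ t, ρ ⟨of k (D.ι t), hTS t⟩ = ⟨of k (D.ι (D.σ t)), hTS _⟩ := fun t =>
    Subtype.ext (hxu.mul_right_cancel (by rw [← hρ]; exact D.of_x_mul t))
  have hnzd : NoZeroDivisors S := ⟨by
    rintro ⟨β, hβ⟩ ⟨γ, hγ⟩ h
    obtain ⟨c, t, hc, ht⟩ := hS β hβ
    obtain ⟨d, s, hd, hs⟩ := hS γ hγ
    have h' : β * γ = 0 := congrArg Subtype.val h
    have h0 : of k (D.ι (t * s)) = 0 := by
      rw [map_mul, of_mul, ← ht, ← hs, smul_mul_smul_comm, h', smul_zero]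
    have h1 : t * s = 0 := D.ι_injective (hinj (by rw [h0, map_zero, of_zero]))
    rcases mul_eq_zero.1 h1 with rfl | rfl
    · refine Or.inl (Subtype.ext ((smul_eq_zero_iff_right hc).1 ?_))
      rw [ht, map_zero, of_zero]
    · refine Or.inr (Subtype.ext ((smul_eq_zero_iff_right hd).1 ?_))
      rw [hs, map_zero, of_zero]⟩
  have hdom : IsDomain S := NoZeroDivisors.to_isDomain S
  let g : S := ⟨of k (D.ι D.u), hTS _⟩
  have hne : ∀ {s t : T}, s ≠ t → (⟨of k (D.ι s), hTS s⟩ : S) ≠ ⟨of k (D.ι t), hTS t⟩ :=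
    fun h h' => h (D.ι_injective (hinj (congrArg Subtype.val h')))
  have hg₁ : ρ g ≠ g := by rw [hρT]; exact hne (D.σ_u_ne h3 hab)
  have hg₂ : ρ (ρ g) ≠ g := by rw [hρT, hρT]; exact hne (D.σ_σ_u_ne h3 hab)
  set m : Polynomial Q := X ^ 3 - C (3 * algebraMap _ Q (D.toCenter ha D.r D.σ_r)) * X
        - C (2 * algebraMap _ Q (D.toCenter ha D.s (D.σ_s h2))) with hm
  have hmdeg : m.natDegree = 3 := by rw [hm]; compute_degree!
  have hmonic : m.Monic := by rw [hm]; monicity!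
  obtain ⟨hmin, hfield, hfin, hrank⟩ := Algebra.adjoin_singleton_of_cubic ρ (g := g) rfl hg₁ hg₂
    hmonic hmdeg (D.aeval_u ha h2)
  refine ⟨hmin, ρ, ⟨hfield, hfin, ?_⟩, ?_, ?_, ?_⟩
  · refine ⟨inferInstance, inferInstance, ⟨fun β hβ => ?_⟩⟩
    have hβ' : ρ β = β := hβ ⟨ρ, Subgroup.mem_zpowers ρ⟩
    obtain ⟨c, t, hc, ht⟩ := hS β β.2
    have e := hρ β
    rw [hβ'] at e
    -- `ρ` is conjugation by `x`, so a fixed element has a central numerator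
    have hσ : D.σ t = t := by
      refine D.ι_injective (hinj (hxu.mul_right_cancel ?_))
      rw [← D.of_x_mul, ← ht, mul_smul_comm, e, smul_mul_assoc]
    refine ⟨c⁻¹ * algebraMap _ Q (D.toCenter ha t hσ), Subtype.ext ?_⟩
    change algebraMap Q B _ = β.1
    rw [map_mul, ← of_center, algebraMap_toCenter, ← ht, ← Algebra.smul_def, smul_smul,
      inv_mul_cancel₀ hc, one_smul]
  · rw [hρT, D.σ_u]
  · exact CyclicAlg.exists_algEquiv_adjoin hrank ρ (hk a ha) hρ hx3 hg₁ hg₂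
      fun U hU hx => D.eq_top_of_mem ha hx (hU (hTS _))
  · have hw3 : of k (D.ι D.w * x) ^ 3 = algebraMap Q B (algebraMap k Q (b / a)) := by
      rw [← of_pow, D.w_mul_x_pow ha, of_algebraMap]
    have hw : ∀ s : S, of k (D.ι D.w * x) * (s : B) = (ρ s : B) * of k (D.ι D.w * x) := by
      intro s
      have hc : (⟨of k (D.ι D.w), hTS _⟩ : S) * ρ s = ρ s * ⟨of k (D.ι D.w), hTS _⟩ :=
        mul_comm _ _
      have hc' : of k (D.ι D.w) * (ρ s : B) = ρ s * of k (D.ι D.w) := congrArg Subtype.val hc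
      rw [of_mul, mul_assoc, hρ, ← mul_assoc, hc', mul_assoc]
    obtain ⟨e, -⟩ := CyclicAlg.exists_algEquiv_adjoin hrank ρ (hk (b / a) (div_ne_zero hb ha)) hw
      hw3 hg₁ hg₂ fun U hU hx => D.eq_top_of_mem ha (by
        have := mul_mem (hU (hTS D.w')) hx
        rwa [← of_mul, ← mul_assoc, ← map_mul, mul_comm, D.w_mul_w' ha hb, map_one, one_mul]
          at this) (hU (hTS _))
    exact ⟨e⟩

end CliffordCrossedData

/-! ### Symbol algebras and extension of scalars -/

namespace CliffordCrossedData

open CentralQuot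

section symbol

variable {k : Type u} {A : Type v} [Field k] [Ring A] [Algebra k A] {a b : k} {x y : A}
  {T : Type v} [CommRing T] [Algebra k T] (D : CliffordCrossedData a b x y T)

/-- The element `y x - ω x y` of `T`. -/
def z (ω : k) : T := D.P - algebraMap k T ω * D.Q

lemma ι_z (ω : k) : D.ι (D.z ω) = y * x - ω • (x * y) := by
  rw [z, map_sub, map_mul, AlgHom.commutes, D.ι_P, D.ι_Q, Algebra.smul_def]

variable {ω : k} (hω : IsPrimitiveRoot ω 3)
include hω

lemma algebraMap_omega : 1 + algebraMap k T ω + algebraMap k T ω ^ 2 = 0 := by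
  rw [← map_one (algebraMap k T), ← map_pow, ← map_add, ← map_add, hω.one_add_add_sq, map_zero]

lemma σ_z : D.σ (D.z ω) = algebraMap k T ω * D.z ω := by
  simp only [z, map_sub, map_mul, AlgHom.commutes, D.σ_P, D.σ_Q]
  linear_combination D.Q * algebraMap_omega (T := T) hω

lemma z_mul_z : D.z ω * D.z (ω ^ 2) = D.r := by
  simp only [z, r, map_pow]
  linear_combination (-D.P * D.Q + (algebraMap k T ω - 1) * D.Q ^ 2) * algebraMap_omega (T := T) hω

lemma z_add_z : D.z ω + D.z (ω ^ 2) = D.u := by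
  simp only [z, u, map_pow]
  linear_combination -D.Q * algebraMap_omega (T := T) hω

lemma omega_z_add_z : algebraMap k T ω * D.z ω + algebraMap k T (ω ^ 2) * D.z (ω ^ 2) = D.u' := by
  simp only [z, u', map_pow]
  linear_combination (D.P - D.Q * (algebraMap k T ω ^ 2 - algebraMap k T ω + 1)) *
    algebraMap_omega (T := T) hω

/-- The cube of `z` is `s + √c`. -/
lemma z_cube (h2 : (2 : k) ≠ 0) :
    D.z ω ^ 3 = D.s + algebraMap k T (3 / 2 * (ω - ω ^ 2) * (a * b)) := by
  have h := algebraMap_omega (T := T) hω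
  rw [map_mul _ (3 / 2 * (ω - ω ^ 2)), map_mul _ (3 / 2), map_sub, map_pow]
  simp only [z, s]
  linear_combination -algebraMap k T (3 / 2) * (algebraMap k T ω - algebraMap k T ω ^ 2) * D.rel
    + (algebraMap k T (3 / 2) * D.P * D.Q * (D.Q - D.P) + (1 - algebraMap k T ω) * D.Q ^ 3) * h
    + algebraMap k T ω * D.P * D.Q * (D.P - algebraMap k T ω * D.Q) *
      algebraMap_three_halves (T := T) h2

lemma z_cube_add (h2 : (2 : k) ≠ 0) :
    algebraMap k T (1 / 2) * (D.z ω ^ 3 + D.z (ω ^ 2) ^ 3) = D.s := by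
  have h2' : algebraMap k T (1 / 2) * 2 = 1 := by
    rw [← map_ofNat (algebraMap k T) 2, ← map_mul, one_div, inv_mul_cancel₀ h2, map_one]
  have hω2 : IsPrimitiveRoot (ω ^ 2) 3 := hω.pow_of_coprime 2 (by decide)
  have e : (ω ^ 2) ^ 2 = ω := by linear_combination ω * hω.pow_eq_one
  have e' : algebraMap k T (3 / 2 * (ω ^ 2 - ω) * (a * b)) =
      -algebraMap k T (3 / 2 * (ω - ω ^ 2) * (a * b)) := by
    rw [← map_neg]
    congr 1
    ring
  rw [D.z_cube hω h2, D.z_cube hω2 h2, e, e']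
  linear_combination D.s * h2'

variable [IsDomain T] [IsDomain (AlgCenter k A)]

omit [IsDomain T] in
/-- A subalgebra containing `z` contains `z̄ = r z² / (s + √c)`, hence all of `T`. -/
lemma of_ι_mem_of_z_mem (ha : a ≠ 0) (h2 : (2 : k) ≠ 0)
    {U : Subalgebra (CenterFrac k A) (CentralQuot k A)}
    (hc : algebraMap _ (CenterFrac k A) (D.toCenter ha D.s (D.σ_s h2)) +
      algebraMap k (CenterFrac k A) (3 / 2 * (ω - ω ^ 2) * (a * b)) ≠ 0)
    (hz : of k (D.ι (D.z ω)) ∈ U) (t : T) : of k (D.ι t) ∈ U := by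
  have hz3 : of k (D.ι (D.z ω ^ 3)) = algebraMap (CenterFrac k A) (CentralQuot k A)
      (algebraMap _ (CenterFrac k A) (D.toCenter ha D.s (D.σ_s h2)) +
      algebraMap k (CenterFrac k A) (3 / 2 * (ω - ω ^ 2) * (a * b))) := by
    rw [D.z_cube hω h2, map_add, of_add, AlgHom.commutes, of_algebraMap, map_add, ← of_center,
      D.algebraMap_toCenter]
  have hk : ∀ c : k, of k (D.ι (algebraMap k T c)) ∈ U := fun c => by
    rw [AlgHom.commutes, of_algebraMap]
    exact U.algebraMap_mem _
  have hmul : ∀ {s t : T}, of k (D.ι s) ∈ U → of k (D.ι t) ∈ U → of k (D.ι (s * t)) ∈ U :=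
    fun hs ht => by rw [map_mul, of_mul]; exact mul_mem hs ht
  have hadd : ∀ {s t : T}, of k (D.ι s) ∈ U → of k (D.ι t) ∈ U → of k (D.ι (s + t)) ∈ U :=
    fun hs ht => by rw [map_add, of_add]; exact add_mem hs ht
  have hr : of k (D.ι D.r) ∈ U := by
    rw [← D.algebraMap_toCenter ha D.σ_r, of_center]
    exact U.algebraMap_mem _
  have hz' : of k (D.ι (D.z (ω ^ 2))) ∈ U := by
    have h : of k (D.ι (D.r * (D.z ω * D.z ω))) ∈ U := hmul hr (hmul hz hz)
    rw [show D.r * (D.z ω * D.z ω) = D.z ω ^ 3 * D.z (ω ^ 2) by rw [← D.z_mul_z hω]; ring, map_mul,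
      of_mul, hz3] at h
    have := mul_mem (U.algebraMap_mem
      (algebraMap _ (CenterFrac k A) (D.toCenter ha D.s (D.σ_s h2)) +
      algebraMap k (CenterFrac k A) (3 / 2 * (ω - ω ^ 2) * (a * b)))⁻¹) h
    rwa [← mul_assoc, ← map_mul, inv_mul_cancel₀ hc, map_one, one_mul] at this
  have hne : ω ^ 2 - ω ≠ 0 := by
    rw [sub_ne_zero, pow_two]
    intro h
    exact hω.ne_one (by decide) (mul_left_cancel₀ (hω.ne_zero (by decide)) (by rw [h, mul_one]))
  have hne' : algebraMap k T (ω ^ 2 - ω)⁻¹ * (algebraMap k T ω ^ 2 - algebraMap k T ω) = 1 := by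
    rw [← map_pow, ← map_sub, ← map_mul, inv_mul_cancel₀ hne, map_one]
  have hQ : of k (D.ι D.Q) ∈ U := by
    have e : D.Q = algebraMap k T (ω ^ 2 - ω)⁻¹ * (D.z ω + algebraMap k T (-1) * D.z (ω ^ 2)) := by
      rw [map_neg, map_one]
      simp only [z, map_pow]
      linear_combination -D.Q * hne'
    rw [e]
    exact hmul (hk _) (hadd hz (hmul (hk _) hz'))
  have hP : of k (D.ι D.P) ∈ U := by
    rw [show D.P = D.z ω + algebraMap k T ω * D.Q by simp only [z]; ring]
    exact hadd hz (hmul (hk _) hQ)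
  have ht : t ∈ Algebra.adjoin k {D.P, D.Q} := by rw [D.adjoin_eq_top]; trivial
  induction ht using Algebra.adjoin_induction with
  | mem t ht => rcases ht with rfl | rfl <;> assumption
  | algebraMap c => exact hk c
  | add p q _ _ hp hq => exact hadd hp hq
  | mul p q _ _ hp hq => exact hmul hp hq

/-- The ring of quotients of `A` as a symbol algebra, on the generators `x`, `z` and on `x⁻¹ y`,
`z`. The slots `c` and `q` are variables so that `√c` and `b / a` may come from a subfield. -/
theorem symbol_description (ha : a ≠ 0) (hb : b ≠ 0) (h2 : (2 : k) ≠ 0) (hz : D.z ω ≠ 0) {c q : k}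
    (hc : c = 3 / 2 * (ω - ω ^ 2) * (a * b)) (hq : q = b / a) :
    let Q := CenterFrac k A
    let B := CentralQuot k A
    let v : Q := algebraMap _ Q (D.toCenter ha D.s (D.σ_s h2)) + algebraMap k Q c
    Algebra.adjoin Q {of k x, of k (D.ι (D.z ω))} = ⊤ ∧ v ≠ 0 ∧
      (∃ e : SymbolAlg 3 (algebraMap k Q ω) (algebraMap k Q a) v ≃ₐ[Q] B,
        e (SymbolAlg.i _ _ _ _) = of k x ∧ e (SymbolAlg.j _ _ _ _) = of k (D.ι (D.z ω))) ∧
      Nonempty (SymbolAlg 3 (algebraMap k Q ω) (algebraMap k Q q) v ≃ₐ[Q] B) := by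
  subst hc hq
  intro Q B v
  have h3 := hω.three_ne_zero
  have hinj := D.of_injective ha hb h3
  have : Nontrivial B := by
    have : Nontrivial A := D.ι_injective.nontrivial
    exact hinj.nontrivial
  have hk : ∀ c : k, c ≠ 0 → algebraMap k Q c ≠ 0 := fun c hc => by simpa using hc
  have hx3 : of k x ^ 3 = algebraMap Q B (algebraMap k Q a) := by
    rw [← of_pow, D.x_cube, of_algebraMap]
  have hz3 : of k (D.ι (D.z ω)) ^ 3 = algebraMap Q B v := by
    rw [← of_pow, ← map_pow, D.z_cube hω h2, map_add, of_add, AlgHom.commutes, of_algebraMap,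
      map_add (algebraMap Q B)]
    congr 1
    exact of_center k (D.toCenter ha D.s (D.σ_s h2))
  have hv : v ≠ 0 := by
    intro hv
    rw [hv, map_zero, ← of_pow, ← map_pow] at hz3
    have : D.z ω ^ 3 = 0 := D.ι_injective (hinj (by rw [hz3, map_zero, of_zero]))
    exact hz (pow_eq_zero_iff (by decide) |>.1 this)
  have hxz : of k x * of k (D.ι (D.z ω)) = algebraMap k Q ω • (of k (D.ι (D.z ω)) * of k x) := by
    rw [D.of_x_mul, D.σ_z hω, ← Algebra.smul_def, map_smul, of_smul, smul_mul_assoc]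
  have hgen : Algebra.adjoin Q {of k x, of k (D.ι (D.z ω))} = ⊤ :=
    D.eq_top_of_mem ha (Algebra.subset_adjoin (Or.inl rfl))
      (D.of_ι_mem_of_z_mem hω ha h2 hv (Algebra.subset_adjoin (Or.inr rfl)) _)
  have hωQ : IsPrimitiveRoot (algebraMap k Q ω) 3 := hω.map_of_injective (algebraMap k Q).injective
  refine ⟨hgen, hv, SymbolAlg.exists_algEquiv hωQ (hk a ha) hv hx3 hz3 hxz hgen, ?_⟩
  have hw3 : of k (D.ι D.w * x) ^ 3 = algebraMap Q B (algebraMap k Q (b / a)) := by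
    rw [← of_pow, D.w_mul_x_pow ha, of_algebraMap]
  have hwz : of k (D.ι D.w * x) * of k (D.ι (D.z ω)) =
      algebraMap k Q ω • (of k (D.ι (D.z ω)) * of k (D.ι D.w * x)) := by
    rw [of_mul, mul_assoc, hxz, mul_smul_comm, ← mul_assoc, ← mul_assoc, ← of_mul, ← of_mul,
      ← map_mul, mul_comm, map_mul, of_mul, of_mul]
  have hT := D.of_ι_mem_of_z_mem hω ha h2 hv
    (U := Algebra.adjoin Q {of k (D.ι D.w * x), of k (D.ι (D.z ω))})
    (Algebra.subset_adjoin (Or.inr rfl))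
  obtain ⟨e, -⟩ := SymbolAlg.exists_algEquiv hωQ (hk (b / a) (div_ne_zero hb ha)) hv hw3 hz3 hwz
    (D.eq_top_of_mem ha (by
      have := mul_mem (hT D.w') (Algebra.subset_adjoin (Or.inl rfl))
      rwa [← of_mul, ← mul_assoc, ← map_mul, mul_comm, D.w_mul_w' ha hb, map_one, one_mul]
          at this) (hT _))
  exact ⟨e⟩

end symbol

section extension

variable {L : Type u} {F : Type v} [Field L] [Field F] [Algebra L F] {A : Type u} {A' : Type v}
  [Ring A] [Ring A'] [Algebra L A] [Algebra F A'] [Algebra L A']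
  {a b : L} {x y : A} {x' y' : A'} {T : Type u} {T' : Type v} [CommRing T] [CommRing T']
  [Algebra L T] [Algebra F T'] (D : CliffordCrossedData a b x y T)
  (D' : CliffordCrossedData (algebraMap L F a) (algebraMap L F b) x' y' T')
  (E : A →ₐ[L] A') (hx : E x = x') (hy : E y = y')
include hx hy

lemma map_ι_P : E (D.ι D.P) = D'.ι D'.P := by rw [D.ι_P, D'.ι_P, map_mul, hx, hy]
lemma map_ι_Q : E (D.ι D.Q) = D'.ι D'.Q := by rw [D.ι_Q, D'.ι_Q, map_mul, hx, hy]

lemma map_ι_r : E (D.ι D.r) = D'.ι D'.r := by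
  simp only [r, map_add, map_mul, map_pow, D.map_ι_P D' E hx hy, D.map_ι_Q D' E hx hy]

lemma map_ι_u : E (D.ι D.u) = D'.ι D'.u := by
  simp only [u, map_add, map_mul, map_ofNat, D.map_ι_P D' E hx hy, D.map_ι_Q D' E hx hy]

lemma map_ι_u' : E (D.ι D.u') = D'.ι D'.u' := by
  simp only [u', map_sub, D.map_ι_P D' E hx hy, D.map_ι_Q D' E hx hy]

variable [IsScalarTower L F A']

lemma map_ι_s : E (D.ι D.s) = D'.ι D'.s := by
  have e : algebraMap L A' (3 / 2) = algebraMap F A' (3 / 2) := by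
    rw [IsScalarTower.algebraMap_apply L F A', map_div₀, map_ofNat, map_ofNat]
  simp only [s, map_add, map_sub, map_mul, map_pow, AlgHom.commutes, D.map_ι_P D' E hx hy,
    D.map_ι_Q D' E hx hy, e]

lemma exists_map_ι (t : T) : ∃ t', E (D.ι t) = D'.ι t' := by
  have ht : t ∈ Algebra.adjoin L {D.P, D.Q} := by rw [D.adjoin_eq_top]; trivial
  induction ht using Algebra.adjoin_induction with
  | mem t ht =>
    rcases ht with rfl | rfl
    exacts [⟨_, D.map_ι_P D' E hx hy⟩, ⟨_, D.map_ι_Q D' E hx hy⟩]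
  | algebraMap c =>
    exact ⟨algebraMap F T' (algebraMap L F c), by
      rw [AlgHom.commutes, AlgHom.commutes, AlgHom.commutes, ← IsScalarTower.algebraMap_apply]⟩
  | add p q _ _ hp hq =>
    obtain ⟨p', hp⟩ := hp
    obtain ⟨q', hq⟩ := hq
    exact ⟨p' + q', by simp only [map_add, hp, hq]⟩
  | mul p q _ _ hp hq =>
    obtain ⟨p', hp⟩ := hp
    obtain ⟨q', hq⟩ := hq
    exact ⟨p' * q', by simp only [map_mul, hp, hq]⟩

open Polynomial in
include D in
/-- A homomorphism over `L` from the algebra over `L` to the one over `F` that maps generators to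
generators is injective. -/
theorem injective_of_map [IsDomain T'] (ha : a ≠ 0) (hb : b ≠ 0) (h3 : (3 : L) ≠ 0)
    (hind : ∀ f g : Polynomial F, aeval D'.Q f + aeval D'.Q g * D'.P = 0 → f = 0 ∧ g = 0) :
    Function.Injective E := by
  have hT : ∀ t, E (D.ι t) = 0 → t = 0 := by
    intro t ht
    obtain ⟨n, f, g, h⟩ := D.exists_pow_mul_eq t
    have hE := congrArg (fun t => E (D.ι t)) h
    have hpoly : ∀ f : Polynomial L, E (D.ι (aeval D.Q f)) =
        D'.ι (aeval D'.Q (f.map (algebraMap L F))) := by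
      intro f
      rw [← aeval_algHom_apply, ← aeval_algHom_apply, ← aeval_algHom_apply, aeval_map_algebraMap,
        D.map_ι_Q D' E hx hy]
    simp only [map_add, map_mul, ht, mul_zero, hpoly, D.map_ι_P D' E hx hy] at hE
    rw [← map_mul, ← map_add, eq_comm, map_eq_zero_iff _ D'.ι_injective] at hE
    obtain ⟨hf, hg⟩ := hind _ _ hE
    rw [Polynomial.map_eq_zero] at hf hg
    subst hf hg
    simpa [((D.isUnit_Q (mul_ne_zero ha hb)).pow n).mul_right_eq_zero] using h
  refine (injective_iff_map_eq_zero E).2 fun α hα => ?_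
  obtain ⟨t₀, t₁, t₂, rfl⟩ := D.exists_eq_skew_sum ha α
  obtain ⟨s₀, h₀⟩ := D.exists_map_ι D' E hx hy t₀
  obtain ⟨s₁, h₁⟩ := D.exists_map_ι D' E hx hy t₁
  obtain ⟨s₂, h₂⟩ := D.exists_map_ι D' E hx hy t₂
  simp only [map_add, map_mul, map_pow, h₀, h₁, h₂, hx] at hα
  obtain ⟨rfl, rfl, rfl⟩ := D'.eq_zero_of_skew_sum
    (by rw [← map_ofNat (algebraMap L F) 3]; exact (_root_.map_ne_zero _).2 h3)
    (by simpa using ha) (by simpa using hb) hα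
  rw [hT t₀ (by rw [h₀, map_zero]), hT t₁ (by rw [h₁, map_zero]), hT t₂ (by rw [h₂, map_zero])]
  simp

end extension

end CliffordCrossedData

/-! ### The Clifford algebra of a diagonal cubic form -/

lemma eval_diagCubic {k : Type u} [CommRing k] (a b : k) (p : Fin 2 → k) :
    MvPolynomial.eval p (diagCubic a b) = a * p 0 ^ 3 + b * p 1 ^ 3 := by
  simp [diagCubic]

lemma eval_map_diagCubic {L : Type u} {F : Type v} [CommRing L] [CommRing F] [Algebra L F] (a b : L)
    (p : Fin 2 → F) : MvPolynomial.eval p (MvPolynomial.map (algebraMap L F) (diagCubic a b)) =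
      algebraMap L F a * p 0 ^ 3 + algebraMap L F b * p 1 ^ 3 := by
  simp [diagCubic]

lemma GenClifford.toExtension_gen {k : Type u} [CommRing k] (K : Type v) [CommRing K] [Algebra k K]
    {n : ℕ} (f : MvPolynomial (Fin n) k) (d : ℕ) (i : Fin n) :
    GenClifford.toExtension K f d (GenClifford.gen f d i) =
      GenClifford.gen (MvPolynomial.map (algebraMap k K) f) d i := by
  simp [GenClifford.toExtension, GenClifford.gen]

set_option maxHeartbeats 4000000 in
theorem proposition7p2 {L : Type u} {F : Type v} [Field L] [Field F] [Algebra L F] [Infinite L]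
    (h2 : ringChar L ≠ 2) (h3 : ringChar L ≠ 3)
    (ω : F) (hω : IsPrimitiveRoot ω 3) (hF : L⟮ω⟯ = ⊤)
    (a b : L) (ha : a ≠ 0) (hb : b ≠ 0)
    -- the fixed square root of `c = -27 a² b² / 4`
    (sqrtc : F) (hsqrtc : sqrtc = 3 / 2 * (ω - ω ^ 2) * algebraMap L F (a * b))
    -- the generator `x` of the Clifford algebra over `L`
    (xL : DiagClifford a b) (hxL : xL = GenClifford.gen _ 3 0)
    -- the generators `x`, `y` of the Clifford algebra over `F`
    (x y : DiagCliffordOver F a b)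
    (hx : x = GenClifford.gen _ 3 0) (hy : y = GenClifford.gen _ 3 1)
    (z z' : DiagCliffordOver F a b)
    (hz : z = y * x - ω • (x * y)) (hz' : z' = y * x - ω ^ 2 • (x * y)) :
    -- the algebra over `L` lies in the algebra over `F`, and the centers are integral domains
    Function.Injective (GenClifford.toExtension F (diagCubic a b) 3) ∧
    ∃ (_ : IsDomain (AlgCenter L (DiagClifford a b)))
      (_ : IsDomain (AlgCenter F (DiagCliffordOver F a b)))
      (r s : AlgCenter L (DiagClifford a b)) (u u' : DiagClifford a b)
      (rF sF : AlgCenter F (DiagCliffordOver F a b)),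
      -- `r = z z'` and `s = (z³ + z'³) / 2`, as elements of the centers over `F` and over `L`
      algebraMap _ (DiagCliffordOver F a b) rF = z * z' ∧
      algebraMap _ (DiagCliffordOver F a b) sF = (1 / 2 : F) • (z ^ 3 + z' ^ 3) ∧
      GenClifford.toExtension F (diagCubic a b) 3 (algebraMap _ (DiagClifford a b) r) =
        z * z' ∧
      GenClifford.toExtension F (diagCubic a b) 3 (algebraMap _ (DiagClifford a b) s) =
        (1 / 2 : F) • (z ^ 3 + z' ^ 3) ∧
      -- `u = z + z'` and `u' = ω z + ω² z'`, as elements of the algebra over `L`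
      GenClifford.toExtension F (diagCubic a b) 3 u = z + z' ∧
      GenClifford.toExtension F (diagCubic a b) 3 u' = ω • z + ω ^ 2 • z' ∧
      -- over `F`, with `Q = q(Z)` the quotient field of the center and `B` the ring of quotients
      (let Q := CenterFrac F (DiagCliffordOver F a b)
       let B := CentralQuot F (DiagCliffordOver F a b)
       -- `Q = F(r, s)` and `B = F(r, s){x, z}`
       IntermediateField.adjoin F {algebraMap _ Q rF, algebraMap _ Q sF} = ⊤ ∧
       Algebra.adjoin Q {CentralQuot.of F x, CentralQuot.of F z} = ⊤ ∧
       -- `B = (a, s + √c; F(r, s))_ω`, with standard generators `x`, `z`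
       algebraMap _ Q sF + algebraMap F Q sqrtc ≠ 0 ∧
       (∃ e : SymbolAlg 3 (algebraMap F Q ω) (algebraMap F Q (algebraMap L F a))
             (algebraMap _ Q sF + algebraMap F Q sqrtc) ≃ₐ[Q] B,
           e (SymbolAlg.i _ _ _ _) = CentralQuot.of F x ∧
           e (SymbolAlg.j _ _ _ _) = CentralQuot.of F z) ∧
       -- `B ≅ (b / a, s + √c; F(r, s))_ω`
       Nonempty (SymbolAlg 3 (algebraMap F Q ω) (algebraMap F Q (algebraMap L F (b / a)))
             (algebraMap _ Q sF + algebraMap F Q sqrtc) ≃ₐ[Q] B)) ∧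
      -- over `L`, with `Q = q(Z)` the quotient field of the center, `B` the ring of quotients,
      -- and `S = Q(u)`
      (let Q := CenterFrac L (DiagClifford a b)
       let B := CentralQuot L (DiagClifford a b)
       let S : Subalgebra Q B := Algebra.adjoin Q {CentralQuot.of L u}
       -- `Q = L(r, s)`
       IntermediateField.adjoin L {algebraMap _ Q r, algebraMap _ Q s} = ⊤ ∧
       -- the minimal polynomial of `u` over `L(r, s)`
       minpoly Q (CentralQuot.of L u : B) =
         Polynomial.X ^ 3 - Polynomial.C (3 * algebraMap _ Q r) * Polynomial.X
           - Polynomial.C (2 * algebraMap _ Q s) ∧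
       -- `S` is a cyclic Galois extension of `L(r, s)`; `ρ` maps `z + z'` to `ω z + ω² z'`
       ∃ ρ : S ≃ₐ[Q] S,
         IsCyclicGalois Q S ρ ∧
         (ρ ⟨CentralQuot.of L u, Algebra.self_mem_adjoin_singleton Q _⟩).1 =
           CentralQuot.of L u' ∧
         -- `B = (S / L(r, s), ρ, a)`, with standard generator `x`
         (∃ e : CyclicAlg (S := S) ρ (algebraMap L Q a) ≃ₐ[Q] B,
           (∀ t : S, e (CyclicAlg.incl (S := S) ρ _ t) = t.1) ∧
           e (CyclicAlg.v (S := S) ρ _) = CentralQuot.of L xL) ∧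
         -- `B ≅ (S / L(r, s), ρ, b / a)`
         Nonempty (CyclicAlg (S := S) ρ (algebraMap L Q (b / a)) ≃ₐ[Q] B)) := by
  have hne : ∀ {p : ℕ}, p.Prime → ringChar L ≠ p → (p : L) ≠ 0 := fun {p} hp h h0 => by
    rcases (Nat.dvd_prime hp).1 (ringChar.dvd h0) with h1 | h1
    · have := (ringChar.spec L 1).2 (by simp [h1])
      simp at this
    · exact h h1
  have h2L : (2 : L) ≠ 0 := by exact_mod_cast hne Nat.prime_two h2
  have h3L : (3 : L) ≠ 0 := by exact_mod_cast hne Nat.prime_three h3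
  have h2F : (2 : F) ≠ 0 := by
    rw [← map_ofNat (algebraMap L F) 2]; exact (map_ne_zero _).2 h2L
  have h3F := hω.three_ne_zero
  have haF : algebraMap L F a ≠ 0 := by simpa using ha
  have hbF : algebraMap L F b ≠ 0 := by simpa using hb
  obtain ⟨T, _, _, _, D, hD⟩ := CliffordCrossedData.exists_of_genClifford h2L ha hb (diagCubic a b)
    (eval_diagCubic a b)
  obtain ⟨T', _, _, _, D', hD'⟩ := CliffordCrossedData.exists_of_genClifford h2F haF hbF
    (MvPolynomial.map (algebraMap L F) (diagCubic a b)) (eval_map_diagCubic a b)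
  subst hx hy hxL
  have hzι : z = D'.ι (D'.z ω) := by rw [hz, D'.ι_z]
  have hzι' : z' = D'.ι (D'.z (ω ^ 2)) := by rw [hz', D'.ι_z]
  -- `z` is not zero, because `1` and `P` are independent over `F[Q]`
  have hz0 : D'.z ω ≠ 0 := fun h0 => by
    refine one_ne_zero (hD' (-Polynomial.C ω * Polynomial.X) 1 ?_).2
    rw [← h0, CliffordCrossedData.z]
    simp
    ring
  have hgx := GenClifford.toExtension_gen F (diagCubic a b) 3 0
  have hgy := GenClifford.toExtension_gen F (diagCubic a b) 3 1
  have hr : D'.ι D'.r = z * z' := by rw [hzι, hzι', ← map_mul, D'.z_mul_z hω]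
  have hs : D'.ι D'.s = (1 / 2 : F) • (z ^ 3 + z' ^ 3) := by
    rw [← D'.z_cube_add hω h2F, hzι, hzι', ← Algebra.smul_def, map_smul, map_add, map_pow, map_pow]
  have hu : D'.ι D'.u = z + z' := by rw [hzι, hzι', ← map_add, D'.z_add_z hω]
  have hu' : D'.ι D'.u' = ω • z + ω ^ 2 • z' := by
    rw [hzι, hzι', ← map_smul, ← map_smul, ← map_add, ← D'.omega_z_add_z hω, Algebra.smul_def,
      Algebra.smul_def]
  have hdom := D.isDomain_center ha hb h3L
  have hdom' := D'.isDomain_center haF hbF h3F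
  refine ⟨D.injective_of_map D' _ hgx hgy ha hb h3L hD', hdom, hdom', D.toCenter ha D.r D.σ_r,
    D.toCenter ha D.s (D.σ_s h2L), D.ι D.u, D.ι D.u', D'.toCenter haF D'.r D'.σ_r,
    D'.toCenter haF D'.s (D'.σ_s h2F), hr, hs, (D.map_ι_r D' _ hgx hgy).trans hr,
    (D.map_ι_s D' _ hgx hgy).trans hs, (D.map_ι_u D' _ hgx hgy).trans hu,
    (D.map_ι_u' D' _ hgx hgy).trans hu', ⟨?_, ?_⟩, ?_, ?_⟩
  · exact IntermediateField.adjoin_fractionRing_eq_top (D'.adjoin_center haF hbF h2F h3F)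
  · rw [hzι]
    exact D'.symbol_description hω haF hbF h2F hz0 (by rw [hsqrtc, map_mul]) (map_div₀ _ _ _)
  · exact IntermediateField.adjoin_fractionRing_eq_top (D.adjoin_center ha hb h2L h3L)
  · exact D.cyclic_description ha hb h2L h3L
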